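/- **Setting.** An inference delivery network has a finite set $\mathcal V$ of nodes (of a graph), a finite catalog $\mathcal M$ of models partitioned into the sets $\mathcal M_i$ of models for task $i$, sizes $s^v_m>0$, budgets $b^v$, capacities $L^v_m\in\mathbb N$, and for each node a set of permanently deployed repository models, with indicator vector $\omega=(\omega^v_m)$. There are finitely many request types $\rho=(i,p)$, where $i$ is a task and $p=(p_1,\dots,p_J)$ is a simple path whose last node hosts a repository model for $i$. Serving a request of type $\rho$ on $p_j$ with $m\in\mathcal M_i$ costs $f((p_1,\dots,p_j),m)\in\mathbb R$, $f$ arbitrary. Order the $K_\rho=J|\mathcal M_i|$ pairs $(p_j,m)$ by nondecreasing cost, and let $\gamma^1_\rho\le\dots\le\gamma^{K_\rho}_\rho$ be the costs. In each of $T\ge1$ slots $t$ there are $r^t_\rho\in\mathbb N\cup\{0\}$ requests of type $\rho$, and $l^{t,v}_{\rho,m}\in\mathbb N\cup\{0\}$ is the potential available capacity of model $m$ on node $v$ for them, with $l^{t,v}_{\rho,m}\le\min\{L^v_m,r^t_\rho\}$. Every repository model $m\in\mathcal M_i$ at a node $v$ on the path of a type $\rho$ for task $i$ can serve all the requests for its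 task: $\sum_{\rho'\text{ for task }i}r^t_{\rho'}\le L^v_m$ and $l^{t,v}_{\rho,m}=\min\{L^v_m,r^t_\rho\}$. Otherwise $(\vec r_t,\vec l_t)$ is arbitrary. For $x\in[0,1]^{\mathcal V\times\mathcal M}$ let $z^k_\rho=x^v_m\,l^{t,v}_{\rho,m}$, where $(v,m)$ is the $k$-th pair of $\rho$, and $$C(\vec r_t,\vec l_t,x)=\sum_\rho\sum_{k=1}^{K_\rho}\gamma^k_\rho\min\Big\{r^t_\rho-\sum_{k'<k}z^{k'}_\rho,\;z^k_\rho\Big\}\mathbf 1_{\{\sum_{k'<k}z^{k'}_\rho<r^t_\rho\}},$$ $$G(\vec r_t,\vec l_t,x)=C(\vec r_t,\vec l_t,\omega)-C(\vec r_t,\vec l_t,x),\qquad G_T(x)=\frac1T\sum_{t=1}^TG(\vec r_t,\vec l_t,x).$$ Let $\mathcal X$ be the set of $x\in\{0,1\}^{\mathcal V\times\mathcal M}$ with $x\ge\omega$ and $\sum_mx^v_ms^v_m\le b^v$ for all $v$; assume $\mathcal X\neq\emptyset$ and let $x_*\in\arg\max_{x\in\mathcal X}G_T(x)$. **INFIDA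 on $G_T$ with learning rate $\eta$.** For each node $v$ let $\mathcal Y^v=\{y\in[0,1]^{\mathcal M}:y\ge\omega^v,\ \sum_my_ms^v_m=b^v\}$ if $\sum_ms^v_m\ge b^v$, and $\mathcal Y^v=\{(1,\dots,1)\}$ otherwise. Let $\mathcal D^v=\mathbb R_{>0}^{\mathcal M}$ and $\Phi^v(y)=\sum_ms^v_my_m\log y_m$, with Bregman divergence $D_{\Phi^v}$. Start at $y^v_1=\arg\min_{\mathcal Y^v\cap\mathcal D^v}\Phi^v$. Given $y_t$, let $h^v\in\mathcal D^v$ be the point with $\nabla\Phi^v(h^v)=\nabla\Phi^v(y^v_t)+\eta g^v$, and let $y^v_{t+1}=\arg\min_{y\in\mathcal Y^v\cap\mathcal D^v}D_{\Phi^v}(y,h^v)$. (At a node where $\mathcal Y^v\cap\mathcal D^v=\emptyset$, because the repository models exhaust the budget, the state is constantly $\omega^v$.) Here $g$ is the average over the $T$ slots $\tau$ of the subgradients at $y_t$ with components $$g^v_{\tau,m}=\sum_{\rho}l^{\tau,v}_{\rho,m}\big(\gamma^{K^*_\rho}_\rho-\gamma^{\kappa_\rho(v,m)}_\rho\big)\mathbf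 1_{\{\kappa_\rho(v,m)<K^*_\rho\}},$$ where $\kappa_\rho(v,m)$ is the rank of the pair $(v,m)$ for $\rho$ ($\infty$ if it is not one of the pairs of $\rho$), and $K^*_\rho$ is the least $k$ such that $\sum_{k'\le k}z^{k'}_\rho\ge r^\tau_\rho$ at $y_t$ (and $K_\rho$ if no smaller $k$ has this property). **DepRound**, applied to $y\in[0,1]^{\mathcal M}$ at a node with sizes $s_m$: while at least two coordinates are fractional, pick two of them, $m$ and $m'$, in any way, and move mass between them, keeping $s_my_m+s_{m'}y_{m'}$ constant, until one of them is $0$ or $1$, the direction being random such that expectations are preserved. A last fractional coordinate $y_m$ is replaced by $1$ with probability $y_m$ and by $0$ otherwise (so the output may exceed the budget by at most one model). Nodes round independently. **Proposition 1.** Let the learning rate $\eta_{\tilde T}>0$ used for $\tilde T$ iterations satisfy $\eta_{\tilde T}\to0$ and $\tilde T\eta_{\tilde T}\to\infty$ as $\tilde T\to\infty$ (for instance $\eta_{\tilde T}=c/\sqrt{\tilde T}$ with $c>0$). Run INFIDA on $G_T$ for $\tilde T$ iterations with learning rate $\eta_{\tilde T}$, let $\bar y=\frac1{\tilde T}\sum_{t=1}^{\tilde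 T}y_t$ be the average fractional allocation, and let $\bar x$ be the random allocation sampled from $\bar y$ by DepRound. Then for every $\varepsilon>0$ and all sufficiently large $\tilde T$, $$\mathbb E\big[G_T(\bar x)\big]\ \ge\ \Big(1-\frac1e-\varepsilon\Big)\,G_T(x_*).$$ -/

import Mathlib

open MeasureTheory

/-- An inference delivery network with compute nodes `V`, model catalog `M`, tasks `N` and request
types indexed by `R`. -/
structure IDN (V M N R : Type*) where
  /-- the interconnections of the compute nodes -/
  graph : SimpleGraph V
  /-- the only task that a model is suitable for; `M_i` is the set of `m` with `modelTask m = i` -/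
  modelTask : M → N
  /-- `s^v_m`, the size of model `m` on node `v` -/
  size : V → M → ℝ
  size_pos : ∀ v m, 0 < size v m
  /-- `b^v`, the allocation budget of node `v` -/
  budget : V → ℝ
  /-- the repository models permanently deployed on each node -/
  repo : V → Finset M
  /-- `L^v_m`, the maximum capacity of model `m` on node `v` -/
  capacity : V → M → ℕ
  /-- the task of a request type -/
  task : R → N
  /-- the routing path `p_1, …, p_J` of a request type -/
  path : R → List V
  path_ne : ∀ ρ, path ρ ≠ []
  path_chain : ∀ ρ, (path ρ).IsChain graph.Adj
  path_nodup : ∀ ρ, (path ρ).Nodup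
  /-- the last node of the path hosts a repository model for the task of the request type -/
  repo_end : ∀ ρ, ∃ m ∈ repo ((path ρ).getLast (path_ne ρ)), modelTask m = task ρ
  /-- `f ((p_1, …, p_j), m)`, the cost of serving a request on `p_j` with model `m` when the
  request has travelled along `p_1, …, p_j` -/
  cost : List V → M → ℝ

/-- A batch of requests `r`, and the potential available capacities `l ρ v m` of model `m` on node
`v` for requests of type `ρ`. -/
structure Batch (V M R : Type*) where
  r : R → ℕ
  l : R → V → M → ℕ

namespace IDN

variable {V M N R : Type*} (net : IDN V M N R)

section Serving

variable [Fintype M] [DecidableEq N]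

/-- The node-model pairs `(p_j, m)` that can serve requests of type `ρ`: `p_j` on the path (given
by its position), `m` suitable for the task. -/
abbrev Slot (ρ : R) : Type _ :=
  Fin (net.path ρ).length × {m : M // net.modelTask m = net.task ρ}

/-- `K_ρ`, the number of such pairs. -/
def K (ρ : R) : ℕ := Fintype.card (net.Slot ρ)

/-- `K_ρ` is the length of the path times the number of models for the task. -/
theorem K_eq (ρ : R) :
    net.K ρ = (net.path ρ).length * Fintype.card {m : M // net.modelTask m = net.task ρ} := by
  simp [K, Slot]

theorem K_pos (ρ : R) : 0 < net.K ρ := by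
  obtain ⟨m, -, hm⟩ := net.repo_end ρ
  exact Fintype.card_pos_iff.2 ⟨(⟨0, List.length_pos_iff.2 (net.path_ne ρ)⟩, ⟨m, hm⟩)⟩

/-- The cost `C^{p_j}_{p,m}` of serving a request of type `ρ` on the `j`-th node of its path. -/
def slotCost (ρ : R) (q : net.Slot ρ) : ℝ :=
  net.cost ((net.path ρ).take (q.1 + 1)) q.2

/-- The pairs that can serve `ρ`, listed by nondecreasing cost (ranks start at `0` here). -/
noncomputable def ranked (ρ : R) : Fin (net.K ρ) ≃ net.Slot ρ :=
  (Tuple.sort (net.slotCost ρ ∘ (Fintype.equivFin (net.Slot ρ)).symm)).trans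
    (Fintype.equivFin (net.Slot ρ)).symm

/-- The costs `γ^k_ρ` increase with the rank. -/
theorem ranked_monotone (ρ : R) : Monotone fun k => net.slotCost ρ (net.ranked ρ k) :=
  Tuple.monotone_sort (net.slotCost ρ ∘ (Fintype.equivFin (net.Slot ρ)).symm)

/-- The node of the `k`-th cheapest pair. -/
noncomputable def nodeAt (ρ : R) (k : Fin (net.K ρ)) : V := (net.path ρ).get (net.ranked ρ k).1

/-- The model of the `k`-th cheapest pair. -/
noncomputable def modelAt (ρ : R) (k : Fin (net.K ρ)) : M := (net.ranked ρ k).2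

/-- `γ^k_ρ`, the `k`-th smallest serving cost. -/
noncomputable def gamma (ρ : R) (k : Fin (net.K ρ)) : ℝ := net.slotCost ρ (net.ranked ρ k)

/-- `z^k_ρ(l, x)`, the effective available capacity of the `k`-th cheapest pair under the
(integral or fractional) allocation `x`. -/
noncomputable def effCap (d : Batch V M R) (x : V → M → ℝ) (ρ : R) (k : Fin (net.K ρ)) : ℝ :=
  x (net.nodeAt ρ k) (net.modelAt ρ k) * d.l ρ (net.nodeAt ρ k) (net.modelAt ρ k)

open Classical in
/-- The aggregate serving cost `C(r, l, x)`. -/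
noncomputable def totalCost [Fintype R] (d : Batch V M R) (x : V → M → ℝ) : ℝ :=
  ∑ ρ, ∑ k : Fin (net.K ρ),
    if ∑ k' ∈ Finset.Iio k, net.effCap d x ρ k' < d.r ρ then
      net.gamma ρ k *
        min ((d.r ρ : ℝ) - ∑ k' ∈ Finset.Iio k, net.effCap d x ρ k') (net.effCap d x ρ k)
    else 0

/-- `K*_ρ(y)`, the rank of the worst needed pair: the least `k` such that the `k` cheapest pairs can
serve all requests of type `ρ`; the last rank if no smaller one suffices. -/
noncomputable def worstNeeded (d : Batch V M R) (y : V → M → ℝ) (ρ : R) : Fin (net.K ρ) := by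
  classical
  exact (Finset.univ.filter fun k : Fin (net.K ρ) =>
    (k : ℕ) + 1 = net.K ρ ∨ (d.r ρ : ℝ) ≤ ∑ k' ∈ Finset.Iic k, net.effCap d y ρ k').min'
      ⟨⟨net.K ρ - 1, Nat.sub_lt (net.K_pos ρ) one_pos⟩, by
        have h := net.K_pos ρ
        exact Finset.mem_filter.2 ⟨Finset.mem_univ _, Or.inl (by simp only; omega)⟩⟩

open Classical in
/-- The subgradient of the gain at the fractional allocation `y`. The pair `(v, m)` occurs at most
once among the ranked pairs of `ρ`, and if it does, its rank is `κ_ρ(v, m)`. -/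
noncomputable def subgrad [Fintype R] (d : Batch V M R) (y : V → M → ℝ) (v : V) (m : M) : ℝ :=
  ∑ ρ, ∑ k : Fin (net.K ρ),
    if net.nodeAt ρ k = v ∧ net.modelAt ρ k = m ∧ k < net.worstNeeded d y ρ then
      (d.l ρ v m : ℝ) * (net.gamma ρ (net.worstNeeded d y ρ) - net.gamma ρ k)
    else 0

end Serving

open Classical in
/-- The minimal allocation `ω`: repository models only. -/
noncomputable def minAlloc (v : V) (m : M) : ℝ := if m ∈ net.repo v then 1 else 0

/-- The set `𝒳` of integral allocations that respect the budgets and contain the repositories. -/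
def allocations [Fintype M] : Set (V → M → ℝ) :=
  {x | ∀ v, (∀ m, x v m = 0 ∨ x v m = 1) ∧ ∑ m, x v m * net.size v m ≤ net.budget v ∧
    ∀ m, net.minAlloc v m ≤ x v m}

open Classical in
/-- The set `𝒜` of batches the adversary may select. A repository model on the path of a request
type is able to serve all the requests for its task, and its available capacities are not selected
by the adversary. -/
def Admissible [Fintype R] (d : Batch V M R) : Prop :=
  (∀ ρ, ∀ v ∈ net.path ρ, ∀ m, net.modelTask m = net.task ρ →
    d.l ρ v m ≤ min (net.capacity v m) (d.r ρ)) ∧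
  ∀ ρ, ∀ v ∈ net.path ρ, ∀ m ∈ net.repo v, net.modelTask m = net.task ρ →
    (∑ ρ' with net.task ρ' = net.task ρ, d.r ρ') ≤ net.capacity v m ∧
    d.l ρ v m = min (net.capacity v m) (d.r ρ)

section Gain

variable [Fintype M] [DecidableEq N] [Fintype R]

/-- The allocation gain `G(r, l, x)` of an integral or fractional allocation `x`. -/
noncomputable def gain (d : Batch V M R) (x : V → M → ℝ) : ℝ :=
  net.totalCost d net.minAlloc - net.totalCost d x

/-- The time-averaged gain `G_T`. -/
noncomputable def avgGain {T : ℕ} (d : Fin T → Batch V M R) (x : V → M → ℝ) : ℝ :=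
  (1 / T : ℝ) * ∑ t, net.gain (d t) x

/-- The subgradient of `G_T`: the average of the subgradients of the gains of the `T` slots. -/
noncomputable def avgSubgrad {T : ℕ} (d : Fin T → Batch V M R) (y : V → M → ℝ) (v : V) (m : M) :
    ℝ :=
  (1 / T : ℝ) * ∑ t, net.subgrad (d t) y v m

end Gain

section Algorithm

variable [Fintype M]

/-- The set `𝒴^v` of fractional allocations at node `v`: they use up the budget if the catalog does
not fit in it, are `1` everywhere otherwise, and contain the repository models. -/
def fracSet (v : V) : Set (M → ℝ) :=
  {y | (∀ m, 0 ≤ y m ∧ y m ≤ 1) ∧ (∀ m, net.minAlloc v m ≤ y m) ∧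
    (net.budget v ≤ ∑ m, net.size v m → ∑ m, y m * net.size v m = net.budget v) ∧
    (∑ m, net.size v m < net.budget v → ∀ m, y m = 1)}

/-- The domain `𝒟^v` of the mirror map, the positive orthant. -/
def posOrthant (M : Type*) : Set (M → ℝ) := {y | ∀ m, 0 < y m}

/-- `𝒴^v ∩ 𝒟^v`, the set that the states of INFIDA at node `v` range over. Where it would be empty
because the repository models exhaust the budget of `v`, it is replaced by `𝒴^v`, whose only element
is then the minimal allocation. -/
def states (v : V) : Set (M → ℝ) :=
  {y | y ∈ net.fracSet v ∧ ((net.fracSet v ∩ posOrthant M).Nonempty → y ∈ posOrthant M)}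

/-- The weighted negative entropy `Φ^v`. -/
noncomputable def entropy (v : V) (y : M → ℝ) : ℝ := ∑ m, net.size v m * (y m * Real.log (y m))

/-- The gradient of `Φ^v` on the positive orthant. -/
noncomputable def gradEntropy (v : V) (y : M → ℝ) (m : M) : ℝ :=
  net.size v m * (Real.log (y m) + 1)

/-- The Bregman divergence of `Φ^v`. -/
noncomputable def bregman (v : V) (y y' : M → ℝ) : ℝ :=
  net.entropy v y - net.entropy v y' - ∑ m, net.gradEntropy v y' m * (y m - y' m)

/-- `y` is a minimizer of `f` over `S`. -/
def IsArgmin {α : Type*} (f : α → ℝ) (S : Set α) (y : α) : Prop := y ∈ S ∧ IsMinOn f S y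

/-- `y 0, y 1, …` are the fractional states of INFIDA with learning rate `η`, run on the gain `G_T`:
at each node `v`, start at the minimizer of the mirror map `Φ^v`, then repeat: map the state to the dual space, take a
gradient step, map the result back to the point `h` of the primal space, project it. -/
structure IsInfidaRun [DecidableEq N] [Fintype R] {T : ℕ} (d : Fin T → Batch V M R) (η : ℝ)
    (y : ℕ → V → M → ℝ) : Prop where
  init : ∀ v, IsArgmin (net.entropy v) (net.states v) (y 0 v)
  step : ∀ t v, ∃ h ∈ posOrthant M,
    (∀ m, net.gradEntropy v h m = net.gradEntropy v (y t v) m + η * net.avgSubgrad d (y t) v m) ∧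
    IsArgmin (fun z => net.bregman v z h) (net.states v) (y (t + 1) v)

end Algorithm

end IDN

/-- The average of the first `n` iterates. -/
noncomputable def avgIterate {V M : Type*} (y : ℕ → V → M → ℝ) (n : ℕ) (v : V) (m : M) : ℝ :=
  (1 / n : ℝ) * ∑ t ∈ Finset.range n, y t v m

/-- The real 0-1 vector of a Boolean vector. -/
def boolVec {M : Type*} (x : M → Bool) (m : M) : ℝ := if x m then 1 else 0

/-- Move mass between the coordinates `m` and `m'` of `y`, the aggregate size staying the same. -/
noncomputable def transfer {M : Type*} [DecidableEq M] (s y : M → ℝ) (m m' : M) (δ : ℝ) : M → ℝ :=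
  Function.update (Function.update y m (y m + δ / s m)) m' (y m' - δ / s m')

/-- The mixture of two laws with weights `p` and `1 - p`. -/
noncomputable def mixture {α : Type*} [MeasurableSpace α] (p : ℝ) (μ₁ μ₂ : Measure α) : Measure α :=
  ENNReal.ofReal p • μ₁ + ENNReal.ofReal (1 - p) • μ₂

/-- `DepRound s y μ`: when the sizes are `s` and the input is the fractional vector `y`, the output
of DepRound has the law `μ`. While two coordinates are fractional, two such coordinates `m`, `m'`
are chosen, in any way, possibly at random, and mass is moved from `m'` to `m` or from `m` to `m'`
until one of them becomes `0` or `1`; the direction is drawn so that expectations are preserved.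
When a single fractional coordinate is left, it is rounded to `1` with probability its value. -/
inductive DepRound {M : Type*} [DecidableEq M] (s : M → ℝ) : (M → ℝ) → Measure (M → Bool) → Prop
  | done (x : M → Bool) : DepRound s (boolVec x) (Measure.dirac x)
  | residual (y : M → ℝ) (m : M) (x : M → Bool) (hm : 0 < y m ∧ y m < 1)
      (hx : ∀ m', m' ≠ m → y m' = boolVec x m') :
      DepRound s y (mixture (y m) (Measure.dirac (Function.update x m true))
        (Measure.dirac (Function.update x m false)))
  | pair (y : M → ℝ) (m m' : M) (hne : m ≠ m') (hm : 0 < y m ∧ y m < 1) (hm' : 0 < y m' ∧ y m' < 1)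
      (a b : ℝ) (ha : a = min (s m * (1 - y m)) (s m' * y m'))
      (hb : b = min (s m * y m) (s m' * (1 - y m'))) (μ₁ μ₂ : Measure (M → Bool))
      (h₁ : DepRound s (transfer s y m m' a) μ₁) (h₂ : DepRound s (transfer s y m m' (-b)) μ₂) :
      DepRound s y (mixture (b / (a + b)) μ₁ μ₂)
  | random (y : M → ℝ) (p : ℝ) (hp : 0 ≤ p ∧ p ≤ 1) (μ₁ μ₂ : Measure (M → Bool))
      (h₁ : DepRound s y μ₁) (h₂ : DepRound s y μ₂) : DepRound s y (mixture p μ₁ μ₂)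

/-!
The proof combines three facts about the gain `G` on allocations that contain the repositories.

Shape of the gain. The pairs that can serve a request type `ρ` take requests in the order of their
cost, so the pairs of rank at most `j` together serve `min r (S_j x)`, where `S_j` is linear with
coefficients between `0` and `r` (paths are simple, so no pair occurs twice). Since the repository
at the end of the path makes sure that everything is served, summation by parts (`IDN.totalCost_eq`,
`IDN.gain_eq`) writes `G x` as a nonnegative combination of the functions
`min r (S_j x) - min r (S_j ω)`. Hence `G` is monotone, and the vectors used by the algorithm are
supergradients (`IDN.gain_le_add_subgrad`).

Optimization. Mirror ascent on a function with bounded supergradients satisfies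
`G z ≤ G ȳ + O(1 / (n η) + η)` for each feasible `z` (`IDN.IsInfidaRun.avgGain_le`). The argument is
carried out node by node, with a potential that equals the Bregman divergence from `z` up to a
constant and remains meaningful for `z` on the boundary of the orthant
(`IDN.potential_step_le`). A node without positive feasible points has a single feasible point and
contributes no regret. The optimal integral allocation need not use up the budgets, but it lies
below a feasible fractional point (`IDN.exists_mem_fracSet_ge`), whose gain is at least as large.

Rounding. The output `X` of DepRound satisfies `E ∏ (1 - c X) ≤ ∏ (1 - c y)` for all `c` in the unit
cube (`DepRound.integral_prod_one_sub_le`), because the product is a concave quadratic polynomial in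
the mass moved between two coordinates. Independence of the nodes extends this to all coordinates,
and the classical comparison of `min 1 (c ⬝ X)` with `1 - ∏ (1 - c X)` loses a factor `1 - 1/e`
(`DepRound.mul_min_le_integral_min`). The terms `min r (S_j ω)` do no harm, since each of them is
either `0` or `r`; in the latter case `min r (S_j x) = r` for each `x ≥ ω`
(`IDN.prefix_repo_dichotomy`). Thus the expected gain is at least `(1 - 1/e) G ȳ`
(`IDN.mul_avgGain_le_integral_avgGain`).
-/

/-! ### The gain as a weighted sum of truncated linear functions -/

/-- Requests that are passed along a line of servers with capacities `z`, each of which takes as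
many of the remaining ones as it can: the first servers up to `j` take `min r (z 0 + ⋯ + z j)`. -/
theorem sum_served_eq_min {n : ℕ} {z : Fin n → ℝ} (hz : ∀ k, 0 ≤ z k) {r : ℝ} (hr : 0 ≤ r)
    (j : Fin n) :
    ∑ k ∈ Finset.Iic j, (if ∑ k' ∈ Finset.Iio k, z k' < r then
      min (r - ∑ k' ∈ Finset.Iio k, z k') (z k) else 0) = min r (∑ k ∈ Finset.Iic j, z k) := by
  have hcons : ∀ k : Fin n, ∑ k' ∈ Finset.Iic k, z k' = z k + ∑ k' ∈ Finset.Iio k, z k' := by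
    intro k
    rw [← Finset.Iio_insert, Finset.sum_insert (by simp)]
  have hstep : ∀ k : Fin n, (if ∑ k' ∈ Finset.Iio k, z k' < r then
      min (r - ∑ k' ∈ Finset.Iio k, z k') (z k) else 0) =
      min r (∑ k' ∈ Finset.Iic k, z k') - min r (∑ k' ∈ Finset.Iio k, z k') := by
    intro k
    have := hz k
    rw [hcons]
    split_ifs with h
    · rcases le_total (r - ∑ k' ∈ Finset.Iio k, z k') (z k) with h' | h'
      · rw [min_eq_left h', min_eq_left (by linarith), min_eq_right h.le]
      · rw [min_eq_right h', min_eq_right (by linarith), min_eq_right h.le]; ring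
    · rw [min_eq_left (by linarith), min_eq_left (by linarith)]; ring
  obtain ⟨j, hj⟩ := j
  induction j with
  | zero =>
    have h0 : Finset.Iio (⟨0, hj⟩ : Fin n) = ∅ := by ext k; simp [Fin.lt_def]
    rw [← Finset.Iio_insert, Finset.sum_insert (by simp), hstep, hcons, h0]
    simp [hr]
  | succ i ih =>
    have hi : Finset.Iio (⟨i + 1, hj⟩ : Fin n) = Finset.Iic ⟨i, by omega⟩ := by
      ext k; simp only [Finset.mem_Iio, Finset.mem_Iic, Fin.lt_def, Fin.le_def]; omega
    have hI : Finset.Iic (⟨i + 1, hj⟩ : Fin n) = insert ⟨i + 1, hj⟩ (Finset.Iic ⟨i, by omega⟩) := by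
      rw [← hi, Finset.Iio_insert]
    nth_rewrite 1 [hI]
    rw [Finset.sum_insert (by simp [Fin.le_def]), hstep, hi, ih]
    ring

namespace IDN

variable {V M N R : Type*} (net : IDN V M N R)

section MinAlloc

variable {net}

theorem minAlloc_nonneg (v : V) (m : M) : 0 ≤ net.minAlloc v m := by
  unfold minAlloc; split_ifs <;> norm_num

theorem minAlloc_of_mem {v : V} {m : M} (h : m ∈ net.repo v) : net.minAlloc v m = 1 := if_pos h

theorem minAlloc_of_notMem {v : V} {m : M} (h : m ∉ net.repo v) : net.minAlloc v m = 0 := if_neg h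

end MinAlloc

section Serving

variable [Fintype M] [DecidableEq N]

/-- The rank of the most expensive pair. -/
def lastRank (ρ : R) : Fin (net.K ρ) := ⟨net.K ρ - 1, Nat.sub_lt (net.K_pos ρ) one_pos⟩

theorem le_lastRank (ρ : R) (k : Fin (net.K ρ)) : k ≤ net.lastRank ρ := by
  have := k.2
  simp only [Fin.le_def, lastRank]
  omega

/-- The increment `γ^{j+1}_ρ - γ^j_ρ` of the cost at rank `j`, and `0` at the last rank. -/
noncomputable def costGap (ρ : R) (j : Fin (net.K ρ)) : ℝ :=
  if h : (j : ℕ) + 1 < net.K ρ then net.gamma ρ ⟨j + 1, h⟩ - net.gamma ρ j else 0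

theorem costGap_nonneg (ρ : R) (j : Fin (net.K ρ)) : 0 ≤ net.costGap ρ j := by
  unfold costGap
  split_ifs with h
  · exact sub_nonneg.2 (net.ranked_monotone ρ (by simp [Fin.le_def]))
  · rfl

theorem sum_Ico_costGap (ρ : R) {k l : Fin (net.K ρ)} (hkl : k ≤ l) :
    ∑ j ∈ Finset.Ico k l, net.costGap ρ j = net.gamma ρ l - net.gamma ρ k := by
  obtain ⟨l, hl⟩ := l
  obtain ⟨k, hk⟩ := k
  rw [Fin.mk_le_mk] at hkl
  induction l, hkl using Nat.le_induction with
  | base => simp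
  | succ i hi ih =>
    have hI : Finset.Ico (⟨k, hk⟩ : Fin (net.K ρ)) ⟨i + 1, hl⟩ =
        insert ⟨i, by omega⟩ (Finset.Ico ⟨k, hk⟩ ⟨i, by omega⟩) := by
      ext j
      simp only [Finset.mem_Ico, Finset.mem_insert, Fin.lt_def, Fin.le_def, Fin.ext_iff]
      omega
    rw [hI, Finset.sum_insert (by simp), ih (by omega)]
    simp only [costGap, dif_pos hl]
    ring

theorem sum_Ici_costGap (ρ : R) (k : Fin (net.K ρ)) :
    ∑ j ∈ Finset.Ici k, net.costGap ρ j = net.gamma ρ (net.lastRank ρ) - net.gamma ρ k := by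
  have hI : Finset.Ici k = insert (net.lastRank ρ) (Finset.Ico k (net.lastRank ρ)) := by
    ext j
    have := net.le_lastRank ρ j
    have := net.le_lastRank ρ k
    simp only [Finset.mem_Ico, Finset.mem_insert, Finset.mem_Ici]
    constructor
    · intro h; rcases eq_or_lt_of_le (net.le_lastRank ρ j) with h' | h' <;> simp [h, h']
    · rintro (rfl | h)
      · assumption
      · exact h.1
  have hlast : net.costGap ρ (net.lastRank ρ) = 0 := by
    unfold costGap lastRank
    rw [dif_neg]
    have := net.K_pos ρ
    simp only
    omega
  rw [hI, Finset.sum_insert (by simp), hlast, zero_add, net.sum_Ico_costGap ρ (net.le_lastRank ρ k)]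

open Classical in
/-- The available capacity of model `m` on node `v` for requests of type `ρ` if `(v, m)` is among
the pairs of rank at most `j`, and `0` otherwise. -/
noncomputable def prefixLoad (d : Batch V M R) (ρ : R) (j : Fin (net.K ρ)) (v : V) (m : M) : ℝ :=
  ∑ k ∈ Finset.Iic j, if net.nodeAt ρ k = v ∧ net.modelAt ρ k = m then (d.l ρ v m : ℝ) else 0

theorem prefixLoad_nonneg (d : Batch V M R) (ρ : R) (j : Fin (net.K ρ)) (v : V) (m : M) :
    0 ≤ net.prefixLoad d ρ j v m :=
  Finset.sum_nonneg fun k _ => by split_ifs <;> positivity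

theorem sum_prefixLoad [Fintype V] (d : Batch V M R) (x : V → M → ℝ) (ρ : R)
    (j : Fin (net.K ρ)) :
    ∑ v, ∑ m, net.prefixLoad d ρ j v m * x v m = ∑ k ∈ Finset.Iic j, net.effCap d x ρ k := by
  classical
  simp only [prefixLoad, Finset.sum_mul]
  rw [Finset.sum_congr rfl fun v _ => Finset.sum_comm, Finset.sum_comm]
  refine Finset.sum_congr rfl fun k _ => ?_
  rw [Finset.sum_eq_single (net.nodeAt ρ k), Finset.sum_eq_single (net.modelAt ρ k)]
  · simp [effCap, mul_comm]
  · intro m _ hm; simp [hm.symm]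
  · simp
  · intro v _ hv; simp [hv.symm]
  · simp

theorem nodeAt_mem_path (ρ : R) (k : Fin (net.K ρ)) : net.nodeAt ρ k ∈ net.path ρ :=
  List.get_mem _ _

theorem modelTask_modelAt (ρ : R) (k : Fin (net.K ρ)) :
    net.modelTask (net.modelAt ρ k) = net.task ρ :=
  (net.ranked ρ k).2.2

/-- The paths are simple, so distinct ranks belong to distinct node-model pairs. -/
theorem rank_injective (ρ : R) {k k' : Fin (net.K ρ)} (hv : net.nodeAt ρ k = net.nodeAt ρ k')
    (hm : net.modelAt ρ k = net.modelAt ρ k') : k = k' := by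
  refine (net.ranked ρ).injective (Prod.ext ?_ (Subtype.ext hm))
  exact List.nodup_iff_injective_get.1 (net.path_nodup ρ) hv

variable {net}

theorem exists_rank_mem_repo (ρ : R) :
    ∃ k, net.modelAt ρ k ∈ net.repo (net.nodeAt ρ k) := by
  obtain ⟨m, hm, hm'⟩ := net.repo_end ρ
  have hlen := List.length_pos_iff.2 (net.path_ne ρ)
  refine ⟨(net.ranked ρ).symm (⟨(net.path ρ).length - 1, by omega⟩, ⟨m, hm'⟩), ?_⟩
  simp only [modelAt, nodeAt, Equiv.apply_symm_apply]
  rwa [List.getLast_eq_getElem] at hm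

theorem sum_lt_of_lt_worstNeeded {d : Batch V M R} {y : V → M → ℝ} {ρ : R} {j : Fin (net.K ρ)}
    (h : j < net.worstNeeded d y ρ) : ∑ k ∈ Finset.Iic j, net.effCap d y ρ k < d.r ρ := by
  classical
  by_contra! h'
  exact absurd (Finset.min'_le _ j (Finset.mem_filter.2 ⟨Finset.mem_univ _, Or.inr h'⟩))
    (not_le.2 h)

theorem effCap_nonneg (d : Batch V M R) {x : V → M → ℝ}
    (hx : ∀ v m, net.minAlloc v m ≤ x v m) (ρ : R) (k : Fin (net.K ρ)) :
    0 ≤ net.effCap d x ρ k :=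
  mul_nonneg ((minAlloc_nonneg _ _).trans (hx _ _)) (Nat.cast_nonneg _)

variable [Fintype R]

theorem prefixLoad_le {d : Batch V M R} (hd : net.Admissible d) (ρ : R) (j : Fin (net.K ρ))
    (v : V) (m : M) : net.prefixLoad d ρ j v m ≤ d.r ρ := by
  classical
  by_cases h : ∃ k, net.nodeAt ρ k = v ∧ net.modelAt ρ k = m
  · obtain ⟨k, rfl, rfl⟩ := h
    have hl : (d.l ρ (net.nodeAt ρ k) (net.modelAt ρ k) : ℝ) ≤ d.r ρ := by
      exact_mod_cast (hd.1 ρ _ (net.nodeAt_mem_path ρ k) _ (net.modelTask_modelAt ρ k)).trans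
        (min_le_right _ _)
    refine le_trans ?_ hl
    unfold prefixLoad
    refine (Finset.sum_le_sum_of_subset_of_nonneg (Finset.subset_univ _) fun _ _ _ => by
      split_ifs <;> positivity).trans ?_
    rw [Finset.sum_eq_single k]
    · simp
    · intro k' _ hk'
      rw [if_neg]
      exact fun h => hk' (net.rank_injective ρ h.1 h.2)
    · simp
  · unfold prefixLoad
    rw [Finset.sum_eq_zero]
    · positivity
    · intro k _
      rw [if_neg fun h' => h ⟨k, h'⟩]

/-- A repository model alone can serve all the requests. -/
theorem le_effCap_of_mem_repo {d : Batch V M R} (hd : net.Admissible d) {x : V → M → ℝ}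
    (hx : ∀ v m, net.minAlloc v m ≤ x v m) (ρ : R) {k : Fin (net.K ρ)}
    (hk : net.modelAt ρ k ∈ net.repo (net.nodeAt ρ k)) : (d.r ρ : ℝ) ≤ net.effCap d x ρ k := by
  classical
  obtain ⟨h1, h2⟩ := hd.2 ρ _ (net.nodeAt_mem_path ρ k) _ hk (net.modelTask_modelAt ρ k)
  have h3 : d.r ρ ≤ net.capacity (net.nodeAt ρ k) (net.modelAt ρ k) :=
    le_trans (Finset.single_le_sum (f := d.r) (fun _ _ => Nat.zero_le _) (by simp)) h1
  have h4 := hx (net.nodeAt ρ k) (net.modelAt ρ k)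
  rw [minAlloc_of_mem hk] at h4
  rw [effCap, h2, min_eq_right h3]
  nlinarith [(Nat.cast_nonneg (d.r ρ) : (0 : ℝ) ≤ d.r ρ)]

theorem le_sum_effCap_of_mem_repo {d : Batch V M R} (hd : net.Admissible d) {x : V → M → ℝ}
    (hx : ∀ v m, net.minAlloc v m ≤ x v m) (ρ : R) {j k : Fin (net.K ρ)} (hkj : k ≤ j)
    (hk : net.modelAt ρ k ∈ net.repo (net.nodeAt ρ k)) :
    (d.r ρ : ℝ) ≤ ∑ k ∈ Finset.Iic j, net.effCap d x ρ k :=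
  (le_effCap_of_mem_repo hd hx ρ hk).trans
    (Finset.single_le_sum (fun k _ => effCap_nonneg d hx ρ k) (Finset.mem_Iic.2 hkj))

/-- All requests are served in the end: the last node of the path hosts a repository model. -/
theorem le_sum_effCap_lastRank {d : Batch V M R} (hd : net.Admissible d) {x : V → M → ℝ}
    (hx : ∀ v m, net.minAlloc v m ≤ x v m) (ρ : R) :
    (d.r ρ : ℝ) ≤ ∑ k ∈ Finset.Iic (net.lastRank ρ), net.effCap d x ρ k := by
  obtain ⟨k, hk⟩ := exists_rank_mem_repo (net := net) ρ
  exact le_sum_effCap_of_mem_repo hd hx ρ (net.le_lastRank ρ k) hk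

/-- Summation by parts: the cost is that of serving everything at the most expensive pair, minus
the cost gap at `j` times the number of requests served by the pairs of rank at most `j`. -/
theorem totalCost_eq [Fintype V] {d : Batch V M R} (hd : net.Admissible d) {x : V → M → ℝ}
    (hx : ∀ v m, net.minAlloc v m ≤ x v m) :
    net.totalCost d x = ∑ ρ, (net.gamma ρ (net.lastRank ρ) * d.r ρ -
      ∑ j, net.costGap ρ j * min (d.r ρ : ℝ) (∑ v, ∑ m, net.prefixLoad d ρ j v m * x v m)) := by
  classical
  unfold totalCost
  refine Finset.sum_congr rfl fun ρ _ => ?_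
  simp only [sum_prefixLoad]
  have hserved := sum_served_eq_min (effCap_nonneg d hx ρ) (Nat.cast_nonneg (d.r ρ))
  set f : Fin (net.K ρ) → ℝ := fun k =>
    if ∑ k' ∈ Finset.Iio k, net.effCap d x ρ k' < d.r ρ then
      min ((d.r ρ : ℝ) - ∑ k' ∈ Finset.Iio k, net.effCap d x ρ k') (net.effCap d x ρ k) else 0
    with hf
  have htotal : ∑ k, f k = d.r ρ := by
    have h := hserved (net.lastRank ρ)
    rw [min_eq_left (le_sum_effCap_lastRank hd hx ρ)] at h
    rw [← h]
    refine (Finset.sum_congr ?_ fun _ _ => rfl).symm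
    ext k
    simp [net.le_lastRank ρ k]
  calc _ = ∑ k, net.gamma ρ k * f k := by
        refine Finset.sum_congr rfl fun k _ => ?_
        simp only [hf, mul_ite, mul_zero]
    _ = ∑ k, (net.gamma ρ (net.lastRank ρ) * f k -
          ∑ j ∈ Finset.Ici k, net.costGap ρ j * f k) := by
        refine Finset.sum_congr rfl fun k _ => ?_
        rw [← Finset.sum_mul, sum_Ici_costGap]
        ring
    _ = _ := by
        rw [Finset.sum_sub_distrib, ← Finset.mul_sum, htotal]
        congr 1
        rw [Finset.sum_comm' (t' := Finset.univ) (s' := fun j => Finset.Iic j) (by simp)]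
        refine Finset.sum_congr rfl fun j _ => ?_
        rw [← Finset.mul_sum, ← hserved j]

theorem gain_eq [Fintype V] {d : Batch V M R} (hd : net.Admissible d) {x : V → M → ℝ}
    (hx : ∀ v m, net.minAlloc v m ≤ x v m) :
    net.gain d x = ∑ ρ, ∑ j, net.costGap ρ j *
      (min (d.r ρ : ℝ) (∑ v, ∑ m, net.prefixLoad d ρ j v m * x v m) -
        min (d.r ρ : ℝ) (∑ v, ∑ m, net.prefixLoad d ρ j v m * net.minAlloc v m)) := by
  rw [gain, totalCost_eq hd hx, totalCost_eq hd fun _ _ => le_rfl, ← Finset.sum_sub_distrib]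
  refine Finset.sum_congr rfl fun ρ _ => ?_
  simp only [mul_sub, Finset.sum_sub_distrib]
  ring

/-- The repository models of rank at most `j` serve either all requests or none. -/
theorem prefix_repo_dichotomy [Fintype V] {d : Batch V M R} (hd : net.Admissible d) (ρ : R)
    (j : Fin (net.K ρ)) :
    (∀ x : V → M → ℝ, (∀ v m, net.minAlloc v m ≤ x v m) →
      (d.r ρ : ℝ) ≤ ∑ v, ∑ m, net.prefixLoad d ρ j v m * x v m) ∨
    ∑ v, ∑ m, net.prefixLoad d ρ j v m * net.minAlloc v m = 0 := by
  by_cases h : ∃ k ≤ j, net.modelAt ρ k ∈ net.repo (net.nodeAt ρ k)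
  · obtain ⟨k, hkj, hk⟩ := h
    left
    intro x hx
    rw [sum_prefixLoad]
    exact le_sum_effCap_of_mem_repo hd hx ρ hkj hk
  · right
    push Not at h
    rw [sum_prefixLoad]
    refine Finset.sum_eq_zero fun k hk => ?_
    rw [effCap, minAlloc_of_notMem (h k (Finset.mem_Iic.1 hk)), zero_mul]

/-! ### Monotonicity and the supergradient inequality -/

theorem gain_mono [Fintype V] {d : Batch V M R} (hd : net.Admissible d) {x y : V → M → ℝ}
    (hx : ∀ v m, net.minAlloc v m ≤ x v m) (hxy : ∀ v m, x v m ≤ y v m) :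
    net.gain d x ≤ net.gain d y := by
  rw [gain_eq hd hx, gain_eq hd fun v m => (hx v m).trans (hxy v m)]
  gcongr with ρ _ j _ v _ m _
  · exact net.costGap_nonneg ρ j
  · exact net.prefixLoad_nonneg d ρ j v m
  · exact hxy v m

theorem gain_nonneg [Fintype V] {d : Batch V M R} (hd : net.Admissible d) {x : V → M → ℝ}
    (hx : ∀ v m, net.minAlloc v m ≤ x v m) : 0 ≤ net.gain d x := by
  have h := gain_mono hd (fun _ _ => le_rfl) hx
  rwa [gain, sub_self] at h

theorem le_sum_of_worstNeeded_le {d : Batch V M R} (hd : net.Admissible d) {y : V → M → ℝ}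
    (hy : ∀ v m, net.minAlloc v m ≤ y v m) {ρ : R} {j : Fin (net.K ρ)}
    (h : net.worstNeeded d y ρ ≤ j) : (d.r ρ : ℝ) ≤ ∑ k ∈ Finset.Iic j, net.effCap d y ρ k := by
  classical
  have hmem := Finset.min'_mem (Finset.univ.filter fun k : Fin (net.K ρ) =>
    (k : ℕ) + 1 = net.K ρ ∨ (d.r ρ : ℝ) ≤ ∑ k' ∈ Finset.Iic k, net.effCap d y ρ k')
    ⟨net.lastRank ρ, by
      have h := net.K_pos ρ
      exact Finset.mem_filter.2 ⟨Finset.mem_univ _, Or.inl (by simp only [lastRank]; omega)⟩⟩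
  have hw : (net.worstNeeded d y ρ : ℕ) + 1 = net.K ρ ∨ (d.r ρ : ℝ) ≤
      ∑ k' ∈ Finset.Iic (net.worstNeeded d y ρ), net.effCap d y ρ k' :=
    (Finset.mem_filter.1 hmem).2
  have hmono : ∑ k' ∈ Finset.Iic (net.worstNeeded d y ρ), net.effCap d y ρ k' ≤
      ∑ k' ∈ Finset.Iic j, net.effCap d y ρ k' :=
    Finset.sum_le_sum_of_subset_of_nonneg (Finset.Iic_subset_Iic.2 h)
      fun k _ _ => effCap_nonneg d hy ρ k
  rcases hw with hw | hw
  · have hj : j = net.lastRank ρ := by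
      have := net.le_lastRank ρ j
      simp only [Fin.le_def, Fin.ext_iff, lastRank] at *
      omega
    rw [hj]
    exact le_sum_effCap_lastRank hd hy ρ
  · exact hw.trans hmono

/-- Summation by parts in the definition of the subgradient. -/
theorem subgrad_eq (d : Batch V M R) (y : V → M → ℝ) (v : V) (m : M) :
    net.subgrad d y v m = ∑ ρ, ∑ j ∈ Finset.Iio (net.worstNeeded d y ρ),
      net.costGap ρ j * net.prefixLoad d ρ j v m := by
  classical
  unfold subgrad
  refine Finset.sum_congr rfl fun ρ _ => ?_
  simp only [prefixLoad, Finset.mul_sum]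
  rw [Finset.sum_comm' (t' := Finset.univ)
    (s' := fun k => Finset.Ico k (net.worstNeeded d y ρ)) (by simp [and_comm])]
  refine Finset.sum_congr rfl fun k _ => ?_
  rw [← Finset.sum_mul]
  by_cases hk : k < net.worstNeeded d y ρ
  · rw [sum_Ico_costGap _ _ hk.le]
    simp only [hk, and_true]
    split_ifs <;> ring
  · rw [Finset.Ico_eq_empty hk]
    simp [hk]

theorem gain_le_add_subgrad [Fintype V] {d : Batch V M R} (hd : net.Admissible d)
    {x y : V → M → ℝ} (hx : ∀ v m, net.minAlloc v m ≤ x v m)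
    (hy : ∀ v m, net.minAlloc v m ≤ y v m) :
    net.gain d x ≤ net.gain d y + ∑ v, ∑ m, net.subgrad d y v m * (x v m - y v m) := by
  classical
  have hlin : ∑ v, ∑ m, net.subgrad d y v m * (x v m - y v m) =
      ∑ ρ, ∑ j, net.costGap ρ j * (if j < net.worstNeeded d y ρ then
        (∑ v, ∑ m, net.prefixLoad d ρ j v m * x v m) -
          ∑ v, ∑ m, net.prefixLoad d ρ j v m * y v m else 0) := by
    simp only [subgrad_eq, Finset.sum_mul]
    rw [Finset.sum_congr rfl fun v _ => Finset.sum_comm, Finset.sum_comm]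
    refine Finset.sum_congr rfl fun ρ _ => ?_
    rw [Finset.sum_congr rfl fun v _ => Finset.sum_comm, Finset.sum_comm]
    simp only [mul_ite, mul_zero]
    rw [← Finset.sum_filter]
    refine Finset.sum_congr (by ext; simp) fun j _ => ?_
    rw [← Finset.sum_sub_distrib, Finset.mul_sum]
    refine Finset.sum_congr rfl fun v _ => ?_
    rw [← Finset.sum_sub_distrib, Finset.mul_sum]
    exact Finset.sum_congr rfl fun m _ => by ring
  rw [hlin, gain_eq hd hx, gain_eq hd hy, ← Finset.sum_add_distrib]
  refine Finset.sum_le_sum fun ρ _ => ?_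
  rw [← Finset.sum_add_distrib]
  refine Finset.sum_le_sum fun j _ => ?_
  rw [← mul_add]
  refine mul_le_mul_of_nonneg_left ?_ (net.costGap_nonneg ρ j)
  split_ifs with h
  · have := sum_lt_of_lt_worstNeeded h
    rw [← sum_prefixLoad] at this
    rw [min_eq_right this.le]
    linarith [min_le_right (d.r ρ : ℝ) (∑ v, ∑ m, net.prefixLoad d ρ j v m * x v m)]
  · have := le_sum_of_worstNeeded_le hd hy (not_lt.1 h)
    rw [← sum_prefixLoad] at this
    rw [min_eq_left this]
    linarith [min_le_left (d.r ρ : ℝ) (∑ v, ∑ m, net.prefixLoad d ρ j v m * x v m)]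

theorem subgrad_nonneg (d : Batch V M R) (y : V → M → ℝ) (v : V) (m : M) :
    0 ≤ net.subgrad d y v m := by
  rw [subgrad_eq]
  exact Finset.sum_nonneg fun ρ _ => Finset.sum_nonneg fun j _ =>
    mul_nonneg (net.costGap_nonneg ρ j) (net.prefixLoad_nonneg d ρ j v m)

theorem subgrad_le (d : Batch V M R) (y : V → M → ℝ) (v : V) (m : M) :
    net.subgrad d y v m ≤ ∑ ρ, ∑ j, net.costGap ρ j * net.prefixLoad d ρ j v m := by
  rw [subgrad_eq]
  exact Finset.sum_le_sum fun ρ _ => Finset.sum_le_sum_of_subset_of_nonneg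
    (Finset.subset_univ _) fun j _ _ =>
      mul_nonneg (net.costGap_nonneg ρ j) (net.prefixLoad_nonneg d ρ j v m)

variable {T : ℕ} {d : Fin T → Batch V M R}

theorem avgGain_mono [Fintype V] (hd : ∀ t, net.Admissible (d t)) {x y : V → M → ℝ}
    (hx : ∀ v m, net.minAlloc v m ≤ x v m) (hxy : ∀ v m, x v m ≤ y v m) :
    net.avgGain d x ≤ net.avgGain d y :=
  mul_le_mul_of_nonneg_left (Finset.sum_le_sum fun t _ => gain_mono (hd t) hx hxy) (by positivity)

theorem avgGain_nonneg [Fintype V] (hd : ∀ t, net.Admissible (d t)) {x : V → M → ℝ}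
    (hx : ∀ v m, net.minAlloc v m ≤ x v m) : 0 ≤ net.avgGain d x :=
  mul_nonneg (by positivity) (Finset.sum_nonneg fun t _ => gain_nonneg (hd t) hx)

theorem avgGain_le_add_avgSubgrad [Fintype V] (hd : ∀ t, net.Admissible (d t))
    {x y : V → M → ℝ} (hx : ∀ v m, net.minAlloc v m ≤ x v m)
    (hy : ∀ v m, net.minAlloc v m ≤ y v m) :
    net.avgGain d x ≤ net.avgGain d y +
      ∑ v, ∑ m, net.avgSubgrad d y v m * (x v m - y v m) := by
  have hlin : ∑ v, ∑ m, net.avgSubgrad d y v m * (x v m - y v m) =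
      (1 / T : ℝ) * ∑ t, ∑ v, ∑ m, net.subgrad (d t) y v m * (x v m - y v m) := by
    simp only [avgSubgrad, mul_assoc, Finset.sum_mul]
    rw [Finset.sum_comm (s := (Finset.univ : Finset (Fin T)))]
    simp only [Finset.mul_sum]
    exact Finset.sum_congr rfl fun v _ => Finset.sum_comm
  rw [hlin, avgGain, avgGain, ← mul_add, ← Finset.sum_add_distrib]
  exact mul_le_mul_of_nonneg_left
    (Finset.sum_le_sum fun t _ => gain_le_add_subgrad (hd t) hx hy) (by positivity)

/-- The subgradients are bounded independently of the allocation. -/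
theorem exists_avgSubgrad_bound [Finite V] (d : Fin T → Batch V M R) :
    ∃ B, ∀ y v m, 0 ≤ net.avgSubgrad d y v m ∧ net.avgSubgrad d y v m ≤ B := by
  obtain ⟨B, hB⟩ := (Set.finite_range fun p : V × M =>
    (1 / T : ℝ) * ∑ t, ∑ ρ, ∑ j, net.costGap ρ j * net.prefixLoad (d t) ρ j p.1 p.2).bddAbove
  refine ⟨B, fun y v m => ⟨mul_nonneg (by positivity)
    (Finset.sum_nonneg fun t _ => subgrad_nonneg _ _ _ _), ?_⟩⟩
  refine le_trans ?_ (hB ⟨(v, m), rfl⟩)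
  exact mul_le_mul_of_nonneg_left
    (Finset.sum_le_sum fun t _ => subgrad_le _ _ _ _) (by positivity)

end Serving

end IDN

/-! ### Dependent rounding -/

theorem one_sub_sum_le_prod_one_sub {ι : Type*} (s : Finset ι) {a : ι → ℝ}
    (ha : ∀ i, 0 ≤ a i ∧ a i ≤ 1) : 1 - ∑ i ∈ s, a i ≤ ∏ i ∈ s, (1 - a i) := by
  classical
  induction s using Finset.induction_on with
  | empty => simp
  | insert i s hi ih =>
    rw [Finset.sum_insert hi, Finset.prod_insert hi]
    have h1 := Finset.sum_nonneg fun j (_ : j ∈ s) => (ha j).1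
    nlinarith [ha i, mul_nonneg (ha i).1 h1,
      mul_le_mul_of_nonneg_left ih (sub_nonneg.2 (ha i).2)]

theorem one_sub_inv_exp_mul_min_le {s : ℝ} (hs : 0 ≤ s) :
    (1 - 1 / Real.exp 1) * min 1 s ≤ 1 - Real.exp (-s) := by
  have he : 1 / Real.exp 1 = Real.exp (-1) := by rw [Real.exp_neg, one_div]
  rw [he]
  rcases le_total 1 s with h | h
  · rw [min_eq_left h]
    linarith [Real.exp_le_exp.2 (neg_le_neg h)]
  · rw [min_eq_right h]
    -- convexity of the exponential on the segment from `-1` to `0`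
    have := convexOn_exp.2 (Set.mem_univ (-1)) (Set.mem_univ 0) hs (sub_nonneg.2 h) (by ring)
    simp only [smul_eq_mul, Real.exp_zero] at this
    rw [show s * -1 + (1 - s) * 0 = -s by ring] at this
    linarith

theorem boolVec_nonneg {M : Type*} (x : M → Bool) (m : M) : 0 ≤ boolVec x m := by
  unfold boolVec; split_ifs <;> norm_num

theorem boolVec_le_one {M : Type*} (x : M → Bool) (m : M) : boolVec x m ≤ 1 := by
  unfold boolVec; split_ifs <;> norm_num

theorem isProbabilityMeasure_mixture {α : Type*} [MeasurableSpace α] {p : ℝ} (h0 : 0 ≤ p)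
    (h1 : p ≤ 1) {μ₁ μ₂ : Measure α} (hμ₁ : IsProbabilityMeasure μ₁)
    (hμ₂ : IsProbabilityMeasure μ₂) : IsProbabilityMeasure (mixture p μ₁ μ₂) := by
  constructor
  simp only [mixture, Measure.add_apply, Measure.smul_apply, measure_univ, smul_eq_mul, mul_one]
  rw [← ENNReal.ofReal_add h0 (sub_nonneg.2 h1)]
  simp

theorem integral_mixture {α : Type*} [MeasurableSpace α] [Finite α] [MeasurableSingletonClass α]
    {p : ℝ} (h0 : 0 ≤ p) (h1 : p ≤ 1) {μ₁ μ₂ : Measure α} [IsProbabilityMeasure μ₁]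
    [IsProbabilityMeasure μ₂] (f : α → ℝ) :
    ∫ x, f x ∂(mixture p μ₁ μ₂) = p * ∫ x, f x ∂μ₁ + (1 - p) * ∫ x, f x ∂μ₂ := by
  rw [mixture, integral_add_measure (Integrable.of_finite.smul_measure ENNReal.ofReal_ne_top)
    (Integrable.of_finite.smul_measure ENNReal.ofReal_ne_top), integral_smul_measure,
    integral_smul_measure, ENNReal.toReal_ofReal h0, ENNReal.toReal_ofReal (sub_nonneg.2 h1),
    smul_eq_mul, smul_eq_mul]

/-- The largest mass that can be moved between two fractional coordinates is positive. -/
theorem transfer_amounts_pos {M : Type*} {s y : M → ℝ} {m m' : M} (hs : ∀ i, 0 < s i) (hm : 0 < y m ∧ y m < 1)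
    (hm' : 0 < y m' ∧ y m' < 1) :
    0 < min (s m * (1 - y m)) (s m' * y m') ∧ 0 < min (s m * y m) (s m' * (1 - y m')) :=
  ⟨lt_min (mul_pos (hs m) (sub_pos.2 hm.2)) (mul_pos (hs m') hm'.1),
    lt_min (mul_pos (hs m) hm.1) (mul_pos (hs m') (sub_pos.2 hm'.2))⟩

theorem transfer_weight_mem {a b : ℝ} (ha : 0 < a) (hb : 0 < b) :
    0 ≤ b / (a + b) ∧ b / (a + b) ≤ 1 :=
  ⟨by positivity, (div_le_one (by positivity)).2 (by linarith)⟩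

section Transfer

variable {M : Type*} [DecidableEq M] {s y : M → ℝ} {m m' : M}

theorem transfer_left (hne : m ≠ m') (δ : ℝ) : transfer s y m m' δ m = y m + δ / s m := by
  simp [transfer, hne]

theorem transfer_right (δ : ℝ) : transfer s y m m' δ m' = y m' - δ / s m' := by
  simp [transfer]

theorem transfer_of_ne {i : M} (hi : i ≠ m) (hi' : i ≠ m') (δ : ℝ) :
    transfer s y m m' δ i = y i := by
  simp [transfer, hi, hi']

theorem prod_eq_mul_mul_prod_erase [Fintype M] (hne : m ≠ m') (f : M → ℝ) :
    ∏ i, f i = f m * f m' * ∏ i ∈ (Finset.univ.erase m).erase m', f i := by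
  rw [mul_assoc, Finset.mul_prod_erase _ _ (Finset.mem_erase.2 ⟨hne.symm, Finset.mem_univ _⟩),
    Finset.mul_prod_erase _ _ (Finset.mem_univ _)]

/-- As a function of the mass moved between two coordinates, `∏ (1 - c i * y i)` is a concave
quadratic polynomial, so an unbiased random move does not increase it on average. -/
theorem prod_transfer_le [Fintype M] (hs : ∀ i, 0 < s i) (hne : m ≠ m')
    (hy : ∀ i, 0 ≤ y i ∧ y i ≤ 1) {c : M → ℝ} (hc : ∀ i, 0 ≤ c i ∧ c i ≤ 1) {a b : ℝ}
    (ha : 0 < a) (hb : 0 < b) :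
    b / (a + b) * ∏ i, (1 - c i * transfer s y m m' a i) +
      (1 - b / (a + b)) * ∏ i, (1 - c i * transfer s y m m' (-b) i) ≤ ∏ i, (1 - c i * y i) := by
  have hrest : ∀ δ, ∏ i ∈ (Finset.univ.erase m).erase m', (1 - c i * transfer s y m m' δ i) =
      ∏ i ∈ (Finset.univ.erase m).erase m', (1 - c i * y i) := fun δ =>
    Finset.prod_congr rfl fun i hi => by
      simp only [Finset.mem_erase, Finset.mem_univ, and_true] at hi
      rw [transfer_of_ne hi.2 hi.1]
  have hQ : 0 ≤ ∏ i ∈ (Finset.univ.erase m).erase m', (1 - c i * y i) :=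
    Finset.prod_nonneg fun i _ => by nlinarith [hy i, hc i]
  simp only [prod_eq_mul_mul_prod_erase hne, hrest, transfer_left hne, transfer_right]
  set Q := ∏ i ∈ (Finset.univ.erase m).erase m', (1 - c i * y i)
  have hm := hs m
  have hm' := hs m'
  have hab : 0 < a + b := by positivity
  have hdiff : (1 - c m * y m) * (1 - c m' * y m') * Q -
      (b / (a + b) * ((1 - c m * (y m + a / s m)) * (1 - c m' * (y m' - a / s m')) * Q) +
      (1 - b / (a + b)) * ((1 - c m * (y m + -b / s m)) * (1 - c m' * (y m' - -b / s m')) * Q)) =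
      (c m / s m) * (c m' / s m') * (a * b) * Q := by
    field_simp
    ring
  have := mul_nonneg (mul_nonneg (mul_nonneg (div_nonneg (hc m).1 hm.le)
    (div_nonneg (hc m').1 hm'.le)) (mul_pos ha hb).le) hQ
  linarith

end Transfer

namespace DepRound

variable {M : Type*} [DecidableEq M] {s y : M → ℝ} {μ : Measure (M → Bool)}

theorem mem_unitInterval (h : DepRound s y μ) (i : M) : 0 ≤ y i ∧ y i ≤ 1 := by
  induction h with
  | done x => exact ⟨boolVec_nonneg x i, boolVec_le_one x i⟩
  | residual y m x hm hx =>
    by_cases hi : i = m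
    · subst hi; exact ⟨hm.1.le, hm.2.le⟩
    · rw [hx i hi]; exact ⟨boolVec_nonneg x i, boolVec_le_one x i⟩
  | pair y m m' hne hm hm' a b ha hb μ₁ μ₂ h₁ h₂ ih₁ ih₂ =>
    by_cases hi : i = m
    · subst hi; exact ⟨hm.1.le, hm.2.le⟩
    by_cases hi' : i = m'
    · subst hi'; exact ⟨hm'.1.le, hm'.2.le⟩
    rwa [transfer_of_ne hi hi'] at ih₁
  | random y p hp μ₁ μ₂ h₁ h₂ ih₁ ih₂ => exact ih₁

theorem isProbabilityMeasure (hs : ∀ i, 0 < s i) (h : DepRound s y μ) :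
    IsProbabilityMeasure μ := by
  induction h with
  | done x => infer_instance
  | residual y m x hm hx =>
    exact isProbabilityMeasure_mixture hm.1.le hm.2.le inferInstance inferInstance
  | pair y m m' hne hm hm' a b ha hb μ₁ μ₂ h₁ h₂ ih₁ ih₂ =>
    obtain ⟨ha', hb'⟩ := transfer_amounts_pos hs hm hm'
    obtain ⟨h0, h1⟩ := transfer_weight_mem (ha ▸ ha') (hb ▸ hb')
    exact isProbabilityMeasure_mixture h0 h1 ih₁ ih₂
  | random y p hp μ₁ μ₂ h₁ h₂ ih₁ ih₂ =>
    exact isProbabilityMeasure_mixture hp.1 hp.2 ih₁ ih₂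

/-- The form of negative dependence of the output that the rounding guarantee rests on. -/
theorem integral_prod_one_sub_le [Fintype M] (hs : ∀ i, 0 < s i) (h : DepRound s y μ)
    {c : M → ℝ} (hc : ∀ i, 0 ≤ c i ∧ c i ≤ 1) :
    ∫ x, ∏ i, (1 - c i * boolVec x i) ∂μ ≤ ∏ i, (1 - c i * y i) := by
  induction h with
  | done x => rw [integral_dirac]
  | residual y m x hm hx =>
    rw [integral_mixture hm.1.le hm.2.le, integral_dirac, integral_dirac]
    have hrest : ∀ β, ∏ i ∈ Finset.univ.erase m,
        (1 - c i * boolVec (Function.update x m β) i) =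
        ∏ i ∈ Finset.univ.erase m, (1 - c i * y i) := fun β =>
      Finset.prod_congr rfl fun i hi => by
        have hi := Finset.ne_of_mem_erase hi
        rw [hx i hi, boolVec, boolVec, Function.update_of_ne hi]
    simp only [← Finset.mul_prod_erase _ _ (Finset.mem_univ m), hrest]
    simp only [boolVec, Function.update_self, if_true, Bool.false_eq_true, if_false]
    apply le_of_eq
    ring
  | pair y m m' hne hm hm' a b ha hb μ₁ μ₂ h₁ h₂ ih₁ ih₂ =>
    have hy := (DepRound.pair y m m' hne hm hm' a b ha hb μ₁ μ₂ h₁ h₂).mem_unitInterval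
    obtain ⟨ha', hb'⟩ := transfer_amounts_pos hs hm hm'
    rw [← ha] at ha'
    rw [← hb] at hb'
    obtain ⟨h0, h1⟩ := transfer_weight_mem ha' hb'
    have := h₁.isProbabilityMeasure hs
    have := h₂.isProbabilityMeasure hs
    rw [integral_mixture h0 h1]
    exact (add_le_add (mul_le_mul_of_nonneg_left ih₁ h0)
      (mul_le_mul_of_nonneg_left ih₂ (sub_nonneg.2 h1))).trans
      (prod_transfer_le hs hne hy hc ha' hb')
  | random y p hp μ₁ μ₂ h₁ h₂ ih₁ ih₂ =>
    have := h₁.isProbabilityMeasure hs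
    have := h₂.isProbabilityMeasure hs
    rw [integral_mixture hp.1 hp.2]
    nlinarith [mul_le_mul_of_nonneg_left ih₁ hp.1,
      mul_le_mul_of_nonneg_left ih₂ (sub_nonneg.2 hp.2)]

theorem ae_eq_one [Fintype M] (hs : ∀ i, 0 < s i) (h : DepRound s y μ) {i : M} (hi : y i = 1) :
    ∀ᵐ x ∂μ, boolVec x i = 1 := by
  have := h.isProbabilityMeasure hs
  -- the negative dependence inequality for the indicator of `i` reads `E (1 - x i) ≤ 1 - y i`
  have hc : ∀ j, 0 ≤ (Pi.single i 1 : M → ℝ) j ∧ (Pi.single i 1 : M → ℝ) j ≤ 1 := by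
    intro j
    rw [Pi.single_apply]
    split_ifs <;> norm_num
  have hprod : ∀ z : M → ℝ, ∏ j, (1 - (Pi.single i 1 : M → ℝ) j * z j) = 1 - z i := by
    intro z
    rw [Finset.prod_eq_single i] <;> simp +contextual
  have hle := h.integral_prod_one_sub_le hs hc
  simp only [hprod, hi, sub_self] at hle
  have hnn : 0 ≤ fun x : M → Bool => 1 - boolVec x i := fun x =>
    sub_nonneg.2 (boolVec_le_one x i)
  have h0 := (integral_eq_zero_iff_of_nonneg hnn Integrable.of_finite).1
    (le_antisymm hle (integral_nonneg hnn))
  filter_upwards [h0] with x hx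
  simp only [Pi.zero_apply] at hx
  linarith

/-- Rounding independently at each node preserves a truncated linear function `min r (w ⬝ x)` with
`0 ≤ w ≤ r` up to the factor `1 - 1/e`. With `c = w / r`, integral points satisfy
`1 - ∏ (1 - c x) ≤ min 1 (c ⬝ x)`, the expectation of the left side is at least
`1 - ∏ (1 - c y) ≥ 1 - exp (-(c ⬝ y))`, and this is at least `(1 - 1/e) * min 1 (c ⬝ y)`. -/
theorem mul_min_le_integral_min {V : Type*} [Fintype V] [Fintype M] {s y : V → M → ℝ}
    (hs : ∀ v m, 0 < s v m) {μ : V → Measure (M → Bool)}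
    (h : ∀ v, DepRound (s v) (y v) (μ v)) {r : ℝ} (hr : 0 ≤ r) {w : V → M → ℝ}
    (hw : ∀ v m, 0 ≤ w v m ∧ w v m ≤ r) :
    (1 - 1 / Real.exp 1) * min r (∑ v, ∑ m, w v m * y v m) ≤
      ∫ x, min r (∑ v, ∑ m, w v m * boolVec (x v) m) ∂(Measure.pi μ) := by
  have hprob : ∀ v, IsProbabilityMeasure (μ v) := fun v => (h v).isProbabilityMeasure (hs v)
  have hy := fun v => (h v).mem_unitInterval
  rcases hr.eq_or_lt with rfl | hr
  · have hw0 : ∀ v m, w v m = 0 := fun v m => le_antisymm (hw v m).2 (hw v m).1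
    simp [hw0]
  set c : V → M → ℝ := fun v m => w v m / r with hcdef
  have hc : ∀ v m, 0 ≤ c v m ∧ c v m ≤ 1 := fun v m =>
    ⟨div_nonneg (hw v m).1 hr.le, (div_le_one hr).2 (hw v m).2⟩
  have hscale : ∀ x : V → M → ℝ, min r (∑ v, ∑ m, w v m * x v m) =
      r * min 1 (∑ v, ∑ m, c v m * x v m) := by
    intro x
    rw [mul_min_of_nonneg _ _ hr.le, mul_one, Finset.mul_sum]
    congr 1
    refine Finset.sum_congr rfl fun v _ => ?_
    rw [Finset.mul_sum]
    refine Finset.sum_congr rfl fun m _ => ?_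
    simp only [hcdef]
    field_simp
  have hint : ∀ x : V → M → Bool, 1 - ∏ v, ∏ m, (1 - c v m * boolVec (x v) m) ≤
      min 1 (∑ v, ∑ m, c v m * boolVec (x v) m) := by
    intro x
    have hmem : ∀ p : V × M, 0 ≤ c p.1 p.2 * boolVec (x p.1) p.2 ∧
        c p.1 p.2 * boolVec (x p.1) p.2 ≤ 1 := fun p =>
      ⟨mul_nonneg (hc _ _).1 (boolVec_nonneg _ _),
        mul_le_one₀ (hc _ _).2 (boolVec_nonneg _ _) (boolVec_le_one _ _)⟩
    have h1 := one_sub_sum_le_prod_one_sub (Finset.univ : Finset (V × M)) hmem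
    rw [Fintype.sum_prod_type, Fintype.prod_prod_type] at h1
    refine le_min ?_ (by linarith)
    exact sub_le_self _ (Finset.prod_nonneg fun v _ => Finset.prod_nonneg fun m _ =>
      sub_nonneg.2 (hmem (v, m)).2)
  have hexp : ∫ x, ∏ v, ∏ m, (1 - c v m * boolVec (x v) m) ∂(Measure.pi μ) ≤
      Real.exp (-∑ v, ∑ m, c v m * y v m) := by
    rw [integral_fintype_prod_eq_prod (𝕜 := ℝ)
      (fun v (z : M → Bool) => ∏ m, (1 - c v m * boolVec z m)), ← Finset.sum_neg_distrib,
      Real.exp_sum]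
    refine Finset.prod_le_prod (fun v _ => integral_nonneg fun z => Finset.prod_nonneg fun m _ =>
      sub_nonneg.2 (mul_le_one₀ (hc _ _).2 (boolVec_nonneg _ _) (boolVec_le_one _ _))) fun v _ => ?_
    refine ((h v).integral_prod_one_sub_le (hs v) (hc v)).trans ?_
    rw [← Finset.sum_neg_distrib, Real.exp_sum]
    exact Finset.prod_le_prod (fun m _ => sub_nonneg.2 (mul_le_one₀ (hc _ _).2 (hy v m).1
      (hy v m).2)) fun m _ => Real.one_sub_le_exp_neg _
  have hmono := integral_mono (μ := Measure.pi μ) Integrable.of_finite Integrable.of_finite hint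
  rw [integral_sub Integrable.of_finite Integrable.of_finite] at hmono
  simp only [integral_const, probReal_univ, smul_eq_mul, mul_one] at hmono
  have hs0 : 0 ≤ ∑ v, ∑ m, c v m * y v m := Finset.sum_nonneg fun v _ =>
    Finset.sum_nonneg fun m _ => mul_nonneg (hc v m).1 (hy v m).1
  simp only [hscale]
  rw [integral_const_mul, mul_left_comm]
  exact mul_le_mul_of_nonneg_left
    (by linarith [one_sub_inv_exp_mul_min_le hs0]) hr.le

end DepRound

namespace IDN

variable {V M N R : Type*} {net : IDN V M N R}

/-- The rounding guarantee for the gain. -/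
theorem mul_avgGain_le_integral_avgGain [Fintype V] [Fintype M] [DecidableEq M] [DecidableEq N]
    [Fintype R] {T : ℕ} {d : Fin T → Batch V M R} (hd : ∀ t, net.Admissible (d t))
    {y : V → M → ℝ} (hy : ∀ v m, net.minAlloc v m ≤ y v m) {μ : V → Measure (M → Bool)}
    (h : ∀ v, DepRound (net.size v) (y v) (μ v)) :
    (1 - 1 / Real.exp 1) * net.avgGain d y ≤
      ∫ x, net.avgGain d (fun v => boolVec (x v)) ∂(Measure.pi μ) := by
  have hprob : ∀ v, IsProbabilityMeasure (μ v) := fun v =>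
    (h v).isProbabilityMeasure (net.size_pos v)
  have hae : ∀ᵐ x ∂(Measure.pi μ), ∀ v m, net.minAlloc v m ≤ boolVec (x v) m := by
    refine Filter.eventually_all.2 fun v => Filter.eventually_all.2 fun m => ?_
    by_cases hm : m ∈ net.repo v
    · have hy1 : y v m = 1 := le_antisymm ((h v).mem_unitInterval m).2
        (minAlloc_of_mem hm ▸ hy v m)
      filter_upwards [Measure.tendsto_eval_ae_ae.eventually
        ((h v).ae_eq_one (net.size_pos v) hy1)] with x hx
      rw [minAlloc_of_mem hm]
      exact hx.ge
    · filter_upwards with x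
      rw [minAlloc_of_notMem hm]
      exact boolVec_nonneg _ _
  have hgain : ∀ t, (1 - 1 / Real.exp 1) * net.gain (d t) y ≤
      ∫ x, net.gain (d t) (fun v => boolVec (x v)) ∂(Measure.pi μ) := by
    intro t
    rw [integral_congr_ae (hae.mono fun x hx => gain_eq (hd t) hx), gain_eq (hd t) hy,
      integral_finsetSum _ fun _ _ => Integrable.of_finite, Finset.mul_sum]
    refine Finset.sum_le_sum fun ρ _ => ?_
    rw [integral_finsetSum _ fun _ _ => Integrable.of_finite, Finset.mul_sum]
    refine Finset.sum_le_sum fun j _ => ?_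
    rw [integral_const_mul, mul_left_comm]
    refine mul_le_mul_of_nonneg_left ?_ (net.costGap_nonneg ρ j)
    rcases prefix_repo_dichotomy (hd t) ρ j with hj | hj
    · rw [integral_congr_ae (hae.mono fun x hx => by
        rw [min_eq_left (hj _ hx), min_eq_left (hj _ fun _ _ => le_rfl), sub_self]),
        min_eq_left (hj _ hy), min_eq_left (hj _ fun _ _ => le_rfl)]
      simp
    · rw [hj, min_eq_right (Nat.cast_nonneg _)]
      simp only [sub_zero]
      exact DepRound.mul_min_le_integral_min net.size_pos h (Nat.cast_nonneg _)
        fun v m => ⟨net.prefixLoad_nonneg _ ρ j v m, prefixLoad_le (hd t) ρ j v m⟩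
  simp only [avgGain]
  rw [integral_const_mul, integral_finsetSum _ fun _ _ => Integrable.of_finite, mul_left_comm,
    Finset.mul_sum]
  exact mul_le_mul_of_nonneg_left (Finset.sum_le_sum fun t _ => hgain t) (by positivity)

end IDN

/-! ### Mirror ascent -/

/-- A point below the budget can be moved towards the all-ones vector until the budget is met. -/
theorem exists_fill {M : Type*} [Fintype M] {s x : M → ℝ} {b : ℝ} (hx : ∑ m, x m * s m ≤ b)
    (hb : b ≤ ∑ m, s m) : ∃ c, 0 ≤ c ∧ c ≤ 1 ∧ ∑ m, (x m + c * (1 - x m)) * s m = b ∧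
      (∑ m, x m * s m < b → 0 < c) := by
  have hexp : ∀ c : ℝ, ∑ m, (x m + c * (1 - x m)) * s m =
      ∑ m, x m * s m + c * (∑ m, s m - ∑ m, x m * s m) := by
    intro c
    rw [← Finset.sum_sub_distrib, Finset.mul_sum, ← Finset.sum_add_distrib]
    exact Finset.sum_congr rfl fun m _ => by ring
  simp only [hexp]
  rcases hx.eq_or_lt with h | h
  · exact ⟨0, le_rfl, zero_le_one, by linarith, fun h' => absurd h h'.ne⟩
  · have hpos : 0 < ∑ m, s m - ∑ m, x m * s m := by linarith
    refine ⟨(b - ∑ m, x m * s m) / (∑ m, s m - ∑ m, x m * s m), div_nonneg (by linarith) hpos.le,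
      (div_le_one hpos).2 (by linarith), ?_, fun _ => div_pos (by linarith) hpos⟩
    rw [div_mul_cancel₀ _ hpos.ne']
    ring

namespace IDN

variable {V M N R : Type*} {net : IDN V M N R}

theorem minAlloc_le_one (v : V) (m : M) : net.minAlloc v m ≤ 1 := by
  unfold minAlloc; split_ifs <;> norm_num

variable [Fintype M]

/-- Every admissible integral allocation lies below a point of the fractional feasible set. -/
theorem exists_mem_fracSet_ge {x : V → M → ℝ} (hx : x ∈ net.allocations) (v : V) :
    ∃ z ∈ net.fracSet v, ∀ m, x v m ≤ z m := by
  obtain ⟨h01, hbud, hω⟩ := hx v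
  have hx01 : ∀ m, 0 ≤ x v m ∧ x v m ≤ 1 := fun m => by
    rcases h01 m with h | h <;> rw [h] <;> norm_num
  rcases le_or_gt (net.budget v) (∑ m, net.size v m) with hb | hb
  · obtain ⟨c, hc0, hc1, hc, -⟩ := exists_fill hbud hb
    have hge : ∀ m, x v m ≤ x v m + c * (1 - x v m) := fun m =>
      le_add_of_nonneg_right (mul_nonneg hc0 (sub_nonneg.2 (hx01 m).2))
    refine ⟨fun m => x v m + c * (1 - x v m), ⟨fun m => ⟨(hx01 m).1.trans (hge m), ?_⟩,
      fun m => (hω m).trans (hge m), fun _ => hc, fun h => absurd hb (not_le.2 h)⟩, hge⟩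
    nlinarith [hx01 m]
  · exact ⟨fun _ => 1, ⟨fun m => ⟨zero_le_one, le_rfl⟩, minAlloc_le_one v,
      fun h => absurd hb (not_lt.2 h), fun _ _ => rfl⟩, fun m => (hx01 m).2⟩

/-- If the fractional feasible set misses the positive orthant, then the repository models exhaust
the budget, and the minimal allocation is the only feasible point. -/
theorem eq_minAlloc_of_not_nonempty {v : V}
    (hv : ¬ (net.fracSet v ∩ posOrthant M).Nonempty) {y : M → ℝ} (hy : y ∈ net.fracSet v) :
    y = net.minAlloc v := by
  obtain ⟨h01, hω, hbud, hone⟩ := hy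
  rcases le_or_gt (net.budget v) (∑ m, net.size v m) with hb | hb
  · have hle : ∑ m, net.minAlloc v m * net.size v m ≤ ∑ m, y m * net.size v m :=
      Finset.sum_le_sum fun m _ => mul_le_mul_of_nonneg_right (hω m) (net.size_pos v m).le
    rw [hbud hb] at hle
    obtain ⟨c, hc0, hc1, hc, hcpos⟩ := exists_fill hle hb
    rcases hle.eq_or_lt with h | h
    · rw [← hbud hb] at h
      have := (Finset.sum_eq_sum_iff_of_le fun m _ =>
        mul_le_mul_of_nonneg_right (hω m) (net.size_pos v m).le).1 h
      exact funext fun m => (mul_right_cancel₀ (net.size_pos v m).ne' (this m (by simp))).symm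
    · have hcp := hcpos h
      refine absurd ⟨fun m => net.minAlloc v m + c * (1 - net.minAlloc v m), ⟨fun m => ?_,
        fun m => ?_, fun _ => hc, fun h => absurd hb (not_le.2 h)⟩, fun m => ?_⟩ hv
      · have := minAlloc_nonneg (net := net) v m
        have := minAlloc_le_one (net := net) v m
        constructor <;> nlinarith
      · have := minAlloc_le_one (net := net) v m
        nlinarith
      · simp only [minAlloc]
        split_ifs <;> linarith
  · refine absurd ⟨y, ⟨h01, hω, hbud, hone⟩, fun m => ?_⟩ hv
    rw [hone hb m]
    exact one_pos

theorem fracSet_convex (v : V) : Convex ℝ (net.fracSet v) := by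
  intro y hy z hz a b ha hb hab
  obtain ⟨y01, yω, ybud, yone⟩ := hy
  obtain ⟨z01, zω, zbud, zone⟩ := hz
  refine ⟨fun m => ?_, fun m => ?_, fun h => ?_, fun h m => ?_⟩
  · simp only [Pi.add_apply, Pi.smul_apply, smul_eq_mul]
    obtain ⟨h1, h2⟩ := y01 m
    obtain ⟨h3, h4⟩ := z01 m
    constructor <;> nlinarith
  · simp only [Pi.add_apply, Pi.smul_apply, smul_eq_mul]
    have h1 := mul_le_mul_of_nonneg_left (yω m) ha
    have h2 := mul_le_mul_of_nonneg_left (zω m) hb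
    have h3 : net.minAlloc v m = a * net.minAlloc v m + b * net.minAlloc v m := by
      rw [← add_mul, hab, one_mul]
    linarith
  · simp only [Pi.add_apply, Pi.smul_apply, smul_eq_mul, add_mul, mul_assoc,
      Finset.sum_add_distrib, ← Finset.mul_sum]
    rw [ybud h, zbud h, ← add_mul, hab, one_mul]
  · simp only [Pi.add_apply, Pi.smul_apply, smul_eq_mul, yone h m, zone h m]
    linarith

theorem states_eq {v : V} (hv : (net.fracSet v ∩ posOrthant M).Nonempty) :
    net.states v = net.fracSet v ∩ posOrthant M := by
  ext y
  simp [states, hv]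

/-- First-order optimality for a linear perturbation of the entropy. The comparison point `z` may
lie on the boundary of the orthant, since the segment from `y` to `z` stays inside before `z`. -/
theorem IsArgmin.first_order {v : V} (hv : (net.fracSet v ∩ posOrthant M).Nonempty)
    {c y z : M → ℝ} {f : (M → ℝ) → ℝ} {a : ℝ}
    (hf : ∀ x, f x = net.entropy v x - ∑ m, c m * x m + a)
    (hy : IsArgmin f (net.states v) y) (hz : z ∈ net.fracSet v) :
    0 ≤ ∑ m, (net.gradEntropy v y m - c m) * (z m - y m) := by
  obtain ⟨hyS, hmin⟩ := hy
  rw [states_eq hv] at hyS hmin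
  have hypos : ∀ m, 0 < y m := hyS.2
  have hderiv : HasDerivAt (fun t : ℝ => f fun m => y m + t * (z m - y m))
      (∑ m, (net.gradEntropy v y m - c m) * (z m - y m)) 0 := by
    have hcoord : ∀ m, HasDerivAt (fun t : ℝ => y m + t * (z m - y m)) (z m - y m) 0 := fun m => by
      simpa using ((hasDerivAt_id (0 : ℝ)).mul_const (z m - y m)).const_add (y m)
    have hlog : ∀ m, HasDerivAt (fun t : ℝ => (y m + t * (z m - y m)) *
        Real.log (y m + t * (z m - y m))) ((Real.log (y m) + 1) * (z m - y m)) 0 := fun m => by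
      have h := HasDerivAt.comp (h₂ := fun x : ℝ => x * Real.log x) (0 : ℝ)
        (Real.hasDerivAt_mul_log (x := y m + 0 * (z m - y m)) (by simpa using (hypos m).ne'))
        (hcoord m)
      rw [zero_mul, add_zero] at h
      exact h
    simp only [hf, entropy]
    have h := ((HasDerivAt.fun_sum fun m (_ : m ∈ (Finset.univ : Finset M)) =>
      (hlog m).const_mul (net.size v m)).sub (HasDerivAt.fun_sum
        fun m (_ : m ∈ (Finset.univ : Finset M)) => (hcoord m).const_mul (c m))).add_const a
    refine h.congr_deriv ?_
    rw [← Finset.sum_sub_distrib]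
    exact Finset.sum_congr rfl fun m _ => by rw [gradEntropy]; ring
  have hright : ∀ t ∈ Set.Ioo (0 : ℝ) 1, f y ≤ f fun m => y m + t * (z m - y m) := by
    intro t ht
    refine hmin ⟨?_, fun m => ?_⟩
    · have h := fracSet_convex v hyS.1 hz (sub_nonneg.2 ht.2.le) ht.1.le (sub_add_cancel 1 t)
      convert h using 1
      funext m
      simp only [Pi.add_apply, Pi.smul_apply, smul_eq_mul]
      ring
    · have h1 := mul_pos (sub_pos.2 ht.2) (hypos m)
      have h2 := mul_nonneg ht.1.le (hz.1 m).1
      linarith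
  refine ge_of_tendsto hderiv.tendsto_slope_zero_right ?_
  filter_upwards [Ioo_mem_nhdsGT (zero_lt_one' ℝ)] with t ht
  have := hright t ht
  simp only [zero_add, zero_mul, add_zero, smul_eq_mul]
  exact mul_nonneg (inv_nonneg.2 ht.1.le) (sub_nonneg.2 this)

/-- The potential `∑ s (y - z log y)` of the state `y` relative to the comparison point `z`. It
differs from the Bregman divergence `D(z, y)` by a function of `z` only, and suits comparison points
with vanishing coordinates. -/
noncomputable def potential (net : IDN V M N R) (v : V) (z y : M → ℝ) : ℝ :=
  ∑ m, net.size v m * (y m - z m * Real.log (y m))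

theorem potential_nonneg {v : V} {z y : M → ℝ} (hz : ∀ m, 0 ≤ z m) (hy : ∀ m, 0 ≤ y m ∧ y m ≤ 1) :
    0 ≤ net.potential v z y := by
  refine Finset.sum_nonneg fun m _ => mul_nonneg (net.size_pos v m).le ?_
  have := Real.log_nonpos (hy m).1 (hy m).2
  nlinarith [hz m, hy m]

theorem potential_init_le {v : V} (hv : (net.fracSet v ∩ posOrthant M).Nonempty) {y z : M → ℝ}
    (hy : IsArgmin (net.entropy v) (net.states v) y) (hz : z ∈ net.fracSet v) :
    net.potential v z y ≤ 2 * ∑ m, net.size v m := by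
  have hypos : ∀ m, 0 < y m := (states_eq hv ▸ hy.1).2
  have h := hy.first_order (c := 0) (a := 0) hv (by simp) hz
  rw [potential, Finset.mul_sum, ← sub_nonneg, ← Finset.sum_sub_distrib]
  refine h.trans (Finset.sum_le_sum fun m _ => ?_)
  have h1 : -(y m * Real.log (y m)) ≤ 1 - y m := by
    have h2 := mul_le_mul_of_nonneg_left (Real.one_sub_inv_le_log_of_pos (hypos m)) (hypos m).le
    rw [mul_sub, mul_inv_cancel₀ (hypos m).ne'] at h2
    linarith
  have h3 := mul_le_mul_of_nonneg_left h1 (net.size_pos v m).le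
  have h4 := mul_le_mul_of_nonneg_left (hz.1 m).2 (net.size_pos v m).le
  simp only [gradEntropy, Pi.zero_apply, sub_zero]
  nlinarith [net.size_pos v m, hypos m]

/-- One step of mirror ascent along `g`, seen from an arbitrary feasible point `z`. -/
theorem potential_step_le {v : V} (hv : (net.fracSet v ∩ posOrthant M).Nonempty)
    {y y' h z g : M → ℝ} {η : ℝ} (hy : y ∈ net.states v) (hh : h ∈ posOrthant M)
    (hgrad : ∀ m, net.gradEntropy v h m = net.gradEntropy v y m + η * g m)
    (hy' : IsArgmin (fun x => net.bregman v x h) (net.states v) y') (hz : z ∈ net.fracSet v)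
    (hsmall : ∀ m, |η * g m / net.size v m| ≤ 1) :
    net.potential v z y' ≤ net.potential v z y - η * ∑ m, g m * (z m - y m) +
      ∑ m, net.size v m * (η * g m / net.size v m) ^ 2 := by
  rw [states_eq hv] at hy
  have hypos : ∀ m, 0 < y m := hy.2
  have hypos' : ∀ m, 0 < y' m := (states_eq hv ▸ hy'.1).2
  have hopt := hy'.first_order (c := net.gradEntropy v h)
    (a := ∑ m, net.gradEntropy v h m * h m - net.entropy v h) hv (fun x => by
      simp only [bregman, mul_sub, Finset.sum_sub_distrib]; ring) hz
  have hlog : ∀ m, Real.log (h m) = Real.log (y m) + η * g m / net.size v m := by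
    intro m
    have hs := net.size_pos v m
    have := hgrad m
    simp only [gradEntropy] at this
    field_simp
    linarith
  have key : net.potential v z y' +
      ∑ m, (net.gradEntropy v y' m - net.gradEntropy v h m) * (z m - y' m) ≤
      net.potential v z y - η * ∑ m, g m * (z m - y m) +
        ∑ m, net.size v m * (η * g m / net.size v m) ^ 2 := by
    rw [potential, potential, Finset.mul_sum, ← Finset.sum_sub_distrib, ← Finset.sum_add_distrib,
      ← Finset.sum_add_distrib]
    refine Finset.sum_le_sum fun m _ => ?_
    have hs := net.size_pos v m
    set u := η * g m / net.size v m with hu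
    have hηg : η * g m = net.size v m * u := by rw [hu]; field_simp
    have hhexp : h m = y m * Real.exp u := by
      rw [← Real.exp_log (hh m), hlog m, Real.exp_add, Real.exp_log (hypos m)]
    have hexp : Real.exp u - 1 - u ≤ u ^ 2 :=
      (le_abs_self _).trans (Real.abs_exp_sub_one_sub_id_le (hsmall m))
    -- `h ≤ y + y u + u²`, by the second-order bound on the exponential and `y ≤ 1`
    have h1 : h m ≤ y m + y m * u + u ^ 2 := by
      rw [hhexp]
      nlinarith [mul_le_mul_of_nonneg_left hexp (hypos m).le,
        mul_le_mul_of_nonneg_right (hy.1.1 m).2 (sq_nonneg u)]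
    -- `y' - h ≤ y' log (y' / h)`
    have h2 : y' m - h m ≤ y' m * (Real.log (y' m) - Real.log (h m)) := by
      have hlog' := Real.log_le_sub_one_of_pos (div_pos (hh m) (hypos' m))
      rw [Real.log_div (hh m).ne' (hypos' m).ne'] at hlog'
      have := mul_le_mul_of_nonneg_left hlog' (hypos' m).le
      rw [mul_sub (y' m) (h m / y' m), mul_div_cancel₀ _ (hypos' m).ne'] at this
      linarith
    simp only [gradEntropy]
    have h3 : (y' m - z m * Real.log (y' m)) +
        (Real.log (y' m) - Real.log (h m)) * (z m - y' m) ≤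
        (y m - z m * Real.log (y m)) - u * (z m - y m) + u ^ 2 := by
      rw [hlog m] at h2 ⊢
      linarith
    have h4 := mul_le_mul_of_nonneg_left h3 hs.le
    rw [← mul_assoc, hηg]
    linarith
  linarith

/-- The regret of the run at one node, for a step size that is small compared with the sizes. -/
theorem IsInfidaRun.node_regret_le [DecidableEq N] [Fintype R] {T : ℕ} {d : Fin T → Batch V M R}
    {η B : ℝ} {y : ℕ → V → M → ℝ} (hη : 0 < η) (hrun : net.IsInfidaRun d η y)
    (hB : ∀ y v m, 0 ≤ net.avgSubgrad d y v m ∧ net.avgSubgrad d y v m ≤ B) {v : V}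
    (hsmall : ∀ m, η * (B / net.size v m) ≤ 1) {z : M → ℝ} (hz : z ∈ net.fracSet v) (n : ℕ) :
    η * ∑ t ∈ Finset.range n, ∑ m, net.avgSubgrad d (y t) v m * (z m - y t v m) ≤
      2 * ∑ m, net.size v m + n * (η ^ 2 * ∑ m, B ^ 2 / net.size v m) := by
  have hstates : ∀ t, y t v ∈ net.states v := by
    rintro (_ | t)
    · exact (hrun.init v).1
    · obtain ⟨h, -, -, hy⟩ := hrun.step t v
      exact hy.1
  have hBsum : 0 ≤ ∑ m, B ^ 2 / net.size v m :=
    Finset.sum_nonneg fun m _ => div_nonneg (sq_nonneg _) (net.size_pos v m).le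
  have hssum : 0 ≤ ∑ m, net.size v m := Finset.sum_nonneg fun m _ => (net.size_pos v m).le
  by_cases hv : (net.fracSet v ∩ posOrthant M).Nonempty
  · have hpot : net.potential v z (y n v) ≤ 2 * ∑ m, net.size v m -
        η * ∑ t ∈ Finset.range n, ∑ m, net.avgSubgrad d (y t) v m * (z m - y t v m) +
        n * (η ^ 2 * ∑ m, B ^ 2 / net.size v m) := by
      induction n with
      | zero => simpa using potential_init_le hv (hrun.init v) hz
      | succ t ih =>
        obtain ⟨h, hh, hgrad, hy'⟩ := hrun.step t v
        have hu : ∀ m, 0 ≤ η * net.avgSubgrad d (y t) v m / net.size v m ∧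
            η * net.avgSubgrad d (y t) v m / net.size v m ≤ η * (B / net.size v m) := fun m => by
          refine ⟨div_nonneg (mul_nonneg hη.le (hB _ _ _).1) (net.size_pos v m).le, ?_⟩
          rw [mul_div_assoc]
          exact mul_le_mul_of_nonneg_left
            (div_le_div_of_nonneg_right (hB _ _ _).2 (net.size_pos v m).le) hη.le
        have hstep := potential_step_le hv (hstates t) hh hgrad hy' hz
          fun m => by rw [abs_of_nonneg (hu m).1]; exact (hu m).2.trans (hsmall m)
        have hquad : ∑ m, net.size v m * (η * net.avgSubgrad d (y t) v m / net.size v m) ^ 2 ≤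
            η ^ 2 * ∑ m, B ^ 2 / net.size v m := by
          rw [Finset.mul_sum]
          refine Finset.sum_le_sum fun m _ => ?_
          have hs := net.size_pos v m
          refine (mul_le_mul_of_nonneg_left (pow_le_pow_left₀ (hu m).1 (hu m).2 2) hs.le).trans
            (le_of_eq ?_)
          field_simp
        rw [Finset.sum_range_succ]
        push_cast
        linarith
    have := potential_nonneg (net := net) (v := v) (fun m => (hz.1 m).1)
      (hstates n).1.1
    linarith
  · have hzero : ∀ t m, z m - y t v m = 0 := fun t m => by
      rw [eq_minAlloc_of_not_nonempty hv hz, eq_minAlloc_of_not_nonempty hv (hstates t).1, sub_self]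
    simp only [hzero, mul_zero, Finset.sum_const_zero]
    positivity

end IDN

/-! ### The average iterate -/

namespace IDN

variable {V M N R : Type*} {net : IDN V M N R} {y : ℕ → V → M → ℝ}

theorem minAlloc_le_avgIterate (hy : ∀ t v m, net.minAlloc v m ≤ y t v m) {n : ℕ} (hn : 0 < n)
    (v : V) (m : M) : net.minAlloc v m ≤ avgIterate y n v m := by
  have hn' : (0 : ℝ) < n := Nat.cast_pos.2 hn
  have h : ∑ _t ∈ Finset.range n, net.minAlloc v m ≤ ∑ t ∈ Finset.range n, y t v m :=
    Finset.sum_le_sum fun t _ => hy t v m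
  rw [Finset.sum_const, Finset.card_range, nsmul_eq_mul] at h
  rw [avgIterate, one_div, ← div_eq_inv_mul, le_div_iff₀ hn']
  linarith

variable [Fintype M] [DecidableEq N] [Fintype R] {T : ℕ} {d : Fin T → Batch V M R} {η : ℝ}

theorem IsInfidaRun.minAlloc_le (hrun : net.IsInfidaRun d η y) (t : ℕ) (v : V) (m : M) :
    net.minAlloc v m ≤ y t v m := by
  rcases t with _ | t
  · exact (hrun.init v).1.1.2.1 m
  · obtain ⟨h, -, -, hy⟩ := hrun.step t v
    exact hy.1.1.2.1 m

variable [Fintype V]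

/-- Jensen's inequality, by the supergradient inequality at the average. -/
theorem sum_avgGain_le (hd : ∀ t, net.Admissible (d t)) (hy : ∀ t v m, net.minAlloc v m ≤ y t v m)
    {n : ℕ} (hn : 0 < n) :
    ∑ t ∈ Finset.range n, net.avgGain d (y t) ≤ n * net.avgGain d (avgIterate y n) := by
  have h := Finset.sum_le_sum fun t (_ : t ∈ Finset.range n) =>
    avgGain_le_add_avgSubgrad hd (hy t) (minAlloc_le_avgIterate hy hn)
  have hzero : ∀ v m, ∑ t ∈ Finset.range n, (y t v m - avgIterate y n v m) = 0 := fun v m => by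
    have hn' : (n : ℝ) ≠ 0 := Nat.cast_ne_zero.2 hn.ne'
    rw [Finset.sum_sub_distrib, Finset.sum_const, Finset.card_range, nsmul_eq_mul, avgIterate]
    field_simp
    ring
  rw [Finset.sum_add_distrib, Finset.sum_const, Finset.card_range, nsmul_eq_mul, Finset.sum_comm,
    Finset.sum_congr rfl fun v _ => Finset.sum_comm] at h
  simpa only [← Finset.mul_sum, hzero, mul_zero, Finset.sum_const_zero, add_zero] using h

/-- The suboptimality of the average iterate. -/
theorem IsInfidaRun.avgGain_le (hd : ∀ t, net.Admissible (d t)) {B : ℝ} (hη : 0 < η)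
    (hrun : net.IsInfidaRun d η y)
    (hB : ∀ y v m, 0 ≤ net.avgSubgrad d y v m ∧ net.avgSubgrad d y v m ≤ B)
    (hsmall : ∀ v m, η * (B / net.size v m) ≤ 1) {z : V → M → ℝ}
    (hz : ∀ v, z v ∈ net.fracSet v) {n : ℕ} (hn : 0 < n) :
    net.avgGain d z ≤ net.avgGain d (avgIterate y n) +
      ((2 * ∑ v, ∑ m, net.size v m) / (n * η) + η * ∑ v, ∑ m, B ^ 2 / net.size v m) := by
  have hn' : (0 : ℝ) < n := Nat.cast_pos.2 hn
  have hgrad := Finset.sum_le_sum fun t (_ : t ∈ Finset.range n) =>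
    avgGain_le_add_avgSubgrad hd (fun v => (hz v).2.1) (hrun.minAlloc_le t)
  rw [Finset.sum_add_distrib, Finset.sum_const, Finset.card_range, nsmul_eq_mul,
    Finset.sum_comm (s := Finset.range n)] at hgrad
  have hjensen := sum_avgGain_le hd hrun.minAlloc_le hn
  have hregret := Finset.sum_le_sum fun v (_ : v ∈ Finset.univ) =>
    hrun.node_regret_le hη hB (hsmall v) (hz v) n
  rw [← Finset.mul_sum, Finset.sum_add_distrib, ← Finset.mul_sum, ← Finset.mul_sum,
    ← Finset.mul_sum] at hregret
  set A := 2 * ∑ v, ∑ m, net.size v m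
  set Q := ∑ v, ∑ m, B ^ 2 / net.size v m
  have hmul : n * η * net.avgGain d z ≤
      n * η * net.avgGain d (avgIterate y n) + (A + n * (η ^ 2 * Q)) := by
    nlinarith [mul_le_mul_of_nonneg_left (hgrad.trans (add_le_add_left hjensen _)) hη.le]
  have hnη : 0 < n * η := mul_pos hn' hη
  refine le_of_mul_le_mul_left (hmul.trans (le_of_eq ?_)) hnη
  field_simp

end IDN

/-! ### The approximation guarantee -/

theorem proposition1 {V M N R : Type*} [Fintype V] [Fintype M] [DecidableEq M] [DecidableEq N]
    [Fintype R] (net : IDN V M N R)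
    {T : ℕ} (hT : 0 < T) (d : Fin T → Batch V M R) (hd : ∀ t, net.Admissible (d t))
    (η : ℕ → ℝ) (hη : ∀ n, 0 < n → 0 < η n)
    (hη_zero : Filter.Tendsto η Filter.atTop (nhds 0))
    (hη_sum : Filter.Tendsto (fun n : ℕ => (n : ℝ) * η n) Filter.atTop Filter.atTop)
    (xopt : V → M → ℝ) (hxopt : xopt ∈ net.allocations)
    (hmax : IsMaxOn (net.avgGain d) net.allocations xopt)
    (ε : ℝ) (hε : 0 < ε) :
    ∃ T₀ : ℕ, ∀ n ≥ T₀, ∀ y : ℕ → V → M → ℝ, net.IsInfidaRun d (η n) y →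
      ∀ μ : V → Measure (M → Bool),
        (∀ v, DepRound (net.size v) (avgIterate y n v) (μ v)) →
        (1 - 1 / Real.exp 1 - ε) * net.avgGain d xopt ≤
          ∫ x, net.avgGain d (fun v => boolVec (x v)) ∂(Measure.pi μ) := by
  have hxω : ∀ v m, net.minAlloc v m ≤ xopt v m := fun v => (hxopt v).2.2
  choose z hz hxz using IDN.exists_mem_fracSet_ge hxopt
  have hxz' : net.avgGain d xopt ≤ net.avgGain d z := IDN.avgGain_mono hd hxω hxz
  obtain ⟨B, hB⟩ := net.exists_avgSubgrad_bound d
  have he : 0 ≤ 1 - 1 / Real.exp 1 ∧ 1 - 1 / Real.exp 1 ≤ 1 := by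
    have h1 : 1 / Real.exp 1 ≤ 1 :=
      (div_le_one (Real.exp_pos 1)).2 (Real.one_le_exp zero_le_one)
    have h2 : 0 ≤ 1 / Real.exp 1 := by positivity
    constructor <;> linarith
  have hround : ∀ n, 0 < n → ∀ y, net.IsInfidaRun d (η n) y → ∀ μ : V → Measure (M → Bool),
      (∀ v, DepRound (net.size v) (avgIterate y n v) (μ v)) →
      (1 - 1 / Real.exp 1) * net.avgGain d (avgIterate y n) ≤
        ∫ x, net.avgGain d (fun v => boolVec (x v)) ∂(Measure.pi μ) :=
    fun n hn y hy μ hμ => IDN.mul_avgGain_le_integral_avgGain hd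
      (IDN.minAlloc_le_avgIterate hy.minAlloc_le hn) hμ
  rcases (IDN.avgGain_nonneg hd hxω).eq_or_lt with h0 | hpos
  -- if the optimum is `0`, no additive error can be absorbed, but a nonnegative gain is enough
  · refine ⟨1, fun n hn y hy μ hμ => le_trans ?_ (hround n hn y hy μ hμ)⟩
    rw [← h0, mul_zero]
    exact mul_nonneg he.1 (IDN.avgGain_nonneg hd (IDN.minAlloc_le_avgIterate hy.minAlloc_le hn))
  -- otherwise the additive error is eventually at most `ε` times the optimum
  · have hsmall : ∀ᶠ n in Filter.atTop, ∀ v m, η n * (B / net.size v m) ≤ 1 := by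
      refine Filter.eventually_all.2 fun v => Filter.eventually_all.2 fun m => ?_
      have h := hη_zero.mul_const (B / net.size v m)
      rw [zero_mul] at h
      exact h.eventually_le_const one_pos
    have herror := (hη_sum.const_div_atTop (2 * ∑ v, ∑ m, net.size v m)).add
      (hη_zero.mul_const (∑ v, ∑ m, B ^ 2 / net.size v m))
    rw [zero_mul, add_zero] at herror
    have hlarge := (hsmall.and (herror.eventually_le_const (mul_pos hε hpos))).and
      (Filter.eventually_ge_atTop 1)
    obtain ⟨T₀, hT₀⟩ := Filter.eventually_atTop.1 hlarge
    refine ⟨T₀, fun n hn y hy μ hμ => le_trans ?_ (hround n (hT₀ n hn).2 y hy μ hμ)⟩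
    obtain ⟨⟨hs, herr⟩, hn1⟩ := hT₀ n hn
    have hle := hxz'.trans (hy.avgGain_le hd (hη n hn1) hB hs hz hn1)
    have h1 := mul_le_mul_of_nonneg_left
      (sub_le_iff_le_add.2 (hle.trans (add_le_add_right herr _))) he.1
    have h2 := mul_le_mul_of_nonneg_right he.2 (mul_pos hε hpos).le
    linarith
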